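/- **Notation.** For integers $p\ge 0$, $1\le m\le 2^p$ let $t^0_{pm}=\frac{m-1}{2^p}$, $t^1_{pm}=\frac{2m-1}{2^{p+1}}$, $t^2_{pm}=\frac{m}{2^p}$, and let $\chi_{pm}=2^p(\mathbf 1_{[t^0_{pm},t^1_{pm})}-\mathbf 1_{[t^1_{pm},t^2_{pm})})$; moreover $\chi_{00}\equiv 1$ and $\chi_{p0}\equiv 0$ for $p\ge 1$. Let $\varphi_{pm}(t)=\int_0^t\chi_{pm}(s)\,\mathrm ds$ for $p\ge0$, $0\le m\le 2^p$, and $\varphi_{-10}\equiv 1$. For a function $f$ on $[0,1]$ with values in a finite-dimensional normed space put $f_{-10}=f(0)$, $f_{00}=f(1)-f(0)$, $f_{p0}=0$ for $p\ge1$, and $f_{pm}=2f(t^1_{pm})-f(t^0_{pm})-f(t^2_{pm})$ for $p\ge 0$, $m\ge1$; and $$S_Nf=\sum_{-1\le p\le N}\ \sum_{0\le m\le 2^p} f_{pm}\varphi_{pm}\quad(N\ge-1),\qquad \|f\|_\alpha=\sup_{p\ge-1,\,m}2^{p\alpha}|f_{pm}|\in[0,\infty].$$ (The only index of level $p=-1$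 is $m=0$.) For real functions $v,w$ the Lévy area is $$L(v,w)(t)=\sum_{p}\sum_{q<p}\sum_{m,n}(v_{pm}w_{qn}-v_{qn}w_{pm})\int_0^t\varphi_{pm}\,\mathrm d\varphi_{qn},\qquad t\in[0,1],$$ understood as a series over $p$ (it is a finite sum for $v=S_Nv$, $w=S_Nw$); for an $\mathbb R^d$-valued path $f$, $L(f,f)=(L(f^k,f^\ell))_{1\le k,\ell\le d}$. **Theorem.** Let $X=(X_t)_{t\in[0,1]}$ be an $\mathbb R^d$-valued stochastic process on a probability space, with (almost surely) continuous paths, finite second moments and mean zero, whose component processes $X^1,\dots,X^d$ are independent. Let $R(s,t)=(E[X^i_sX^j_t])_{i,j}$ and $R_{[s,t]\times[u,v]}=R(t,v)+R(s,u)-R(s,v)-R(t,u)$. Assume for some $\rho\in[1,2)$: * ($\rho$-var) there is $C>0$ such that for all $0\le s<t\le1$ and every partition $s=t_0<\dots<t_n=t$, $$\sum_{i,j=1}^n|R_{[t_{i-1},t_i]\times[t_{j-1},t_j]}|^\rho\le C|t-s|;$$ * (HC) for every $m\in\mathbb N$ and every real $r\ge1$ there is $C_{r,m}>0$ such that for every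 $n\in\mathbb N$, every polynomial $P:\mathbb R^n\to\mathbb R$ of degree at most $m$, all $i_1,\dots,i_n\in\{1,\dots,d\}$ and all $t_1,\dots,t_n\in[0,1]$, $$E\big(|P(X^{i_1}_{t_1},\dots,X^{i_n}_{t_n})|^{2r}\big)\le C_{r,m}\,E\big(|P(X^{i_1}_{t_1},\dots,X^{i_n}_{t_n})|^2\big)^r.$$ Then for every $\alpha\in(0,1/\rho)$, almost surely $$\sum_{N\ge0}\big\|L(S_NX,S_NX)-L(S_{N-1}X,S_{N-1}X)\big\|_\alpha<\infty .$$ Consequently, almost surely, the series defining $L(X,X)$ converges (absolutely) at every $t\in[0,1]$, $L(S_NX,S_NX)\to L(X,X)$ as $N\to\infty$ both in $\|\cdot\|_\alpha$ and uniformly on $[0,1]$, and $L(X,X)$ is $\alpha$-Hölder continuous on $[0,1]$. -/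

import Mathlib

open MeasureTheory ProbabilityTheory Filter Topology
open scoped ENNReal NNReal Matrix.Norms.Frobenius

noncomputable section

namespace LevyArea

/-! ### Schauder functions

The levels are `p = -1, 0, 1, …`, with positions `0 ≤ m ≤ 2 ^ p`. The only function of level `-1`
is the constant `1`, with coefficient `f 0`; it is written out separately below, so that
`p : ℕ` in all definitions that take a level. -/

/-- The left end point `t⁰_{pm} = (m-1)/2^p` of a dyadic interval (used for `m ≥ 1` only). -/
def time0 (p m : ℕ) : ℝ := ((m : ℝ) - 1) / 2 ^ p

/-- The middle `t¹_{pm} = (2m-1)/2^(p+1)` of `[t⁰, t²]`. -/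
def time1 (p m : ℕ) : ℝ := (2 * (m : ℝ) - 1) / 2 ^ (p + 1)

/-- The right end point `t²_{pm} = m/2^p` of a dyadic interval. -/
def time2 (p m : ℕ) : ℝ := (m : ℝ) / 2 ^ p

/-- The rescaled Haar functions `χ_{pm} = 2^(p/2) H_{pm}`: `χ_{00} = 1`, `χ_{p0} = 0` for `p ≥ 1`,
and for `m ≥ 1` the value is `2^p` on `[t⁰, t¹)`, `-2^p` on `[t¹, t²)` and `0` elsewhere. -/
def haar (p m : ℕ) (t : ℝ) : ℝ :=
  if m = 0 then (if p = 0 then 1 else 0)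
  else if time0 p m ≤ t ∧ t < time1 p m then 2 ^ p
  else if time1 p m ≤ t ∧ t < time2 p m then -2 ^ p
  else 0

/-- The rescaled Schauder functions `φ_{pm} = ∫₀^· χ_{pm}`: `φ_{00}(t) = t`, `φ_{p0} = 0` for
`p ≥ 1`, and for `m ≥ 1` a tent of height `1/2` over `[t⁰, t²]`. -/
def schauder (p m : ℕ) (t : ℝ) : ℝ :=
  if m = 0 then (if p = 0 then t else 0)
  else if time0 p m ≤ t ∧ t < time1 p m then 2 ^ p * (t - time0 p m)
  else if time1 p m ≤ t ∧ t < time2 p m then -2 ^ p * (t - time2 p m)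
  else 0

section Expansion

variable {E : Type*} [NormedAddCommGroup E] [NormedSpace ℝ E]

/-- The Schauder coefficients `f_{pm}`, `p ≥ 0`: `f_{00} = f 1 - f 0`, `f_{p0} = 0` for `p ≥ 1`,
and `f_{pm} = 2 f(t¹) - f(t⁰) - f(t²)` for `m ≥ 1`. (At level `-1`, the coefficient is `f 0`.) -/
def coeff (f : ℝ → E) (p m : ℕ) : E :=
  if m = 0 then (if p = 0 then f 1 - f 0 else 0)
  else (f (time1 p m) - f (time0 p m)) - (f (time2 p m) - f (time1 p m))

/-- The partial sum of the Schauder expansion of `f` over all levels `-1 ≤ p < N`. In the usual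
notation `S_k f = ∑_{-1 ≤ p ≤ k} ∑_m f_{pm} φ_{pm}`, this is `S_{N-1} f`. -/
def partialSum (N : ℕ) (f : ℝ → E) (t : ℝ) : E :=
  f 0 + ∑ p ∈ Finset.range N, ∑ m ∈ Finset.range (2 ^ p + 1), schauder p m t • coeff f p m

/-- The norm `‖f‖_α = sup_{p ≥ -1, m} 2^(pα) |f_{pm}|`, with values in `[0, ∞]`. -/
def schauderNorm (α : ℝ) (f : ℝ → E) : ℝ≥0∞ :=
  max ((2 : ℝ≥0∞) ^ (-α) * ‖f 0‖ₑ)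
    (⨆ p : ℕ, ⨆ m ∈ Finset.range (2 ^ p + 1), (2 : ℝ≥0∞) ^ ((p : ℝ) * α) * ‖coeff f p m‖ₑ)

end Expansion

/-! ### The Lévy area -/

/-- The part of level `p` of the Lévy area,
`∑_{q < p} ∑_{m, n} (v_{pm} w_{qn} - v_{qn} w_{pm}) ∫₀ᵗ φ_{pm} dφ_{qn}`, with `dφ_{qn} = χ_{qn} ds`.
Terms with `q = -1` vanish, because the Schauder function of level `-1` is constant. -/
def levyBlock (v w : ℝ → ℝ) (p : ℕ) (t : ℝ) : ℝ :=
  ∑ q ∈ Finset.range p, ∑ m ∈ Finset.range (2 ^ p + 1), ∑ n ∈ Finset.range (2 ^ q + 1),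
    (coeff v p m * coeff w q n - coeff v q n * coeff w p m) *
      ∫ s in (0 : ℝ)..t, schauder p m s * haar q n s

/-- The Lévy area `L(v, w) = ∑_p` (part of level `p`), taken pointwise in time. -/
def levyArea (v w : ℝ → ℝ) (t : ℝ) : ℝ := ∑' p : ℕ, levyBlock v w p t

/-- The matrix `L(f, f) = (L(f^k, f^l))_{k,l}` of a path `f` in `ℝ^d`. -/
def levyMatrix {d : ℕ} (f : ℝ → Fin d → ℝ) (t : ℝ) : Matrix (Fin d) (Fin d) ℝ :=
  Matrix.of fun k l => levyArea (fun s => f s k) (fun s => f s l) t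

/-! ### Conditions on the process

Processes are indexed by `ℝ`, but only times in `[0, 1]` are ever used. -/

section Conditions

variable {Ω : Type*} [MeasurableSpace Ω] {d : ℕ}

/-- The covariance function `R(s, t) = (E[X^i_s X^j_t])_{i,j}`. -/
def covMatrix (μ : Measure Ω) (X : ℝ → Ω → Fin d → ℝ) (s t : ℝ) : Matrix (Fin d) (Fin d) ℝ :=
  Matrix.of fun i j => ∫ ω, X s ω i * X t ω j ∂μ

/-- The increment of the covariance function over the rectangle `[s, t] × [u, v]`. -/
def covIncrement (μ : Measure Ω) (X : ℝ → Ω → Fin d → ℝ) (s t u v : ℝ) :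
    Matrix (Fin d) (Fin d) ℝ :=
  covMatrix μ X t v + covMatrix μ X s u - covMatrix μ X s v - covMatrix μ X t u

/-- The condition (`ρ`-var): the `ρ`-variation of the covariance over `[s, t]²` along any partition
`s = τ 0 < ⋯ < τ n = t` is at most `C |t - s|`. -/
def RhoVar (μ : Measure Ω) (ρ : ℝ) (X : ℝ → Ω → Fin d → ℝ) : Prop :=
  ∃ C : ℝ, 0 < C ∧ ∀ s t : ℝ, 0 ≤ s → s < t → t ≤ 1 →
    ∀ (n : ℕ) (τ : ℕ → ℝ), τ 0 = s → τ n = t → (∀ i < n, τ i < τ (i + 1)) →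
      ∑ i ∈ Finset.range n, ∑ j ∈ Finset.range n,
        ‖covIncrement μ X (τ i) (τ (i + 1)) (τ j) (τ (j + 1))‖ ^ ρ ≤ C * |t - s|

/-- The condition (HC), hypercontractivity: for polynomials `P` of degree at most `m` in finitely
many values of the process, `E |P|^(2r) ≤ C_{r,m} (E |P|²)^r`. The expectations are taken in
`[0, ∞]`. The constant does not depend on the number `n` of values. -/
def Hypercontractive (μ : Measure Ω) (X : ℝ → Ω → Fin d → ℝ) : Prop :=
  ∀ (m : ℕ) (r : ℝ), 1 ≤ r → ∃ C : ℝ≥0, 0 < C ∧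
    ∀ (n : ℕ) (P : MvPolynomial (Fin n) ℝ), P.totalDegree ≤ m →
      ∀ (i : Fin n → Fin d) (t : Fin n → ℝ), (∀ k, t k ∈ Set.Icc (0 : ℝ) 1) →
        ∫⁻ ω, ‖MvPolynomial.eval (fun k => X (t k) ω (i k)) P‖ₑ ^ (2 * r) ∂μ ≤
          C * (∫⁻ ω, ‖MvPolynomial.eval (fun k => X (t k) ω (i k)) P‖ₑ ^ (2 : ℝ) ∂μ) ^ r

end Conditions

end LevyArea

end

noncomputable section

namespace LevyArea

/-! ### Schauder functions on dyadic cells -/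

/-! On a dyadic cell of level p every tent of level q < p is affine, and its Haar function is
constant. So the coarse levels in block p sum to the difference quotient of the path over the cell
(`sum_coeff_mul_haar`). The block becomes a sum over cells of `cellArea`, an antisymmetric product
of the increments over the two halves, times a function that rises from 0 to 1/2 across the cell
(`levyBlock_eq`). Its increments in time are controlled by sums of `cellArea` over consecutive cells
(`sum_bump_holder`). It remains to bound these sums almost surely by B 2^(-pε) h^α, where h is the
total length of the cells.

For two different components, independence factors the second moment of such a sum into products of
covariances, and the inequality 2ab ≤ a² + b² leaves sums of squared covariances. Since ρ < 2, a
square is at most a supremum to the power 2 - ρ times a term of the ρ-variation. This gives K h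
2^(-p(2/ρ-1)) (`integral_sq_sum_cellArea_le`). Replacing h by h^(2α) costs at most 2^(p max(2α-1,
0)) because h ≥ 2^(-p), and α < 1/ρ makes this cost smaller than the gain.

The sums are quadratic polynomials in the process, so hypercontractivity lifts the estimate to
moments high enough to beat the O(4^p) intervals of level p, and the bound holds almost surely for
all of them at once (`ae_sum_cellArea_le`). Diagonal entries vanish by antisymmetry. Once the Hölder
constants of the blocks are summable, their tails control the distance to the limit
(`levyMatrix_convergence`). -/

theorem time0_succ (q k : ℕ) : time0 q (k + 1) = k / 2 ^ q := by simp [time0]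

theorem time1_succ (q k : ℕ) : time1 q (k + 1) = (2 * k + 1) / 2 ^ (q + 1) := by
  simp only [time1]; push_cast; ring

theorem time2_succ (q k : ℕ) : time2 q (k + 1) = (k + 1) / 2 ^ q := by simp [time2]

theorem time0_lt_time1 (q k : ℕ) : time0 q (k + 1) < time1 q (k + 1) := by
  rw [time0_succ, time1_succ, pow_succ, div_lt_div_iff₀ (by positivity) (by positivity)]
  nlinarith [pow_pos (two_pos : (0 : ℝ) < 2) q]

theorem time1_lt_time2 (q k : ℕ) : time1 q (k + 1) < time2 q (k + 1) := by
  rw [time2_succ, time1_succ, pow_succ, div_lt_div_iff₀ (by positivity) (by positivity)]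
  nlinarith [pow_pos (two_pos : (0 : ℝ) < 2) q]

theorem schauder_zero_right (q : ℕ) (t : ℝ) : schauder q 0 t = if q = 0 then t else 0 := by
  simp [schauder]

theorem haar_zero_right (q : ℕ) (t : ℝ) : haar q 0 t = if q = 0 then 1 else 0 := by
  simp [haar]

theorem schauder_of_le_time0 {q k : ℕ} {t : ℝ} (h : t ≤ time0 q (k + 1)) :
    schauder q (k + 1) t = 0 := by
  have h1 := time0_lt_time1 q k
  rcases h.lt_or_eq with h | h
  · simp [schauder, not_le.2 h, not_le.2 (h.trans h1)]
  · simp [schauder, h, h1.not_ge]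

theorem schauder_left {q k : ℕ} {t : ℝ} (h0 : time0 q (k + 1) ≤ t) (h1 : t ≤ time1 q (k + 1)) :
    schauder q (k + 1) t = 2 ^ q * (t - time0 q (k + 1)) := by
  have h2 := time1_lt_time2 q k
  rcases h1.lt_or_eq with h1 | h1
  · simp [schauder, h0, h1]
  · simp only [schauder, h1, Nat.add_eq_zero_iff, one_ne_zero, and_false, if_false, lt_irrefl,
      le_refl, h2, true_and, if_true]
    rw [time0_succ, time1_succ, time2_succ, pow_succ]
    field_simp
    ring

theorem schauder_right {q k : ℕ} {t : ℝ} (h1 : time1 q (k + 1) ≤ t) (h2 : t ≤ time2 q (k + 1)) :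
    schauder q (k + 1) t = 2 ^ q * (time2 q (k + 1) - t) := by
  rcases h2.lt_or_eq with h2 | h2
  · simp only [schauder, h1, h2, Nat.add_eq_zero_iff, one_ne_zero, and_false, if_false,
      not_lt.2 h1, and_self, if_true]
    ring
  · simp [schauder, h2, (time1_lt_time2 q k).not_gt]

theorem schauder_of_time2_le {q k : ℕ} {t : ℝ} (h : time2 q (k + 1) ≤ t) :
    schauder q (k + 1) t = 0 := by
  have h1 := time1_lt_time2 q k
  simp [schauder, not_lt.2 h, not_lt.2 (h1.le.trans h)]

theorem haar_of_lt_time0 {q k : ℕ} {t : ℝ} (h : t < time0 q (k + 1)) :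
    haar q (k + 1) t = 0 := by
  have h1 := time0_lt_time1 q k
  simp [haar, not_le.2 h, not_le.2 (h.trans h1)]

theorem haar_left {q k : ℕ} {t : ℝ} (h0 : time0 q (k + 1) ≤ t) (h1 : t < time1 q (k + 1)) :
    haar q (k + 1) t = 2 ^ q := by
  simp [haar, h0, h1]

theorem haar_right {q k : ℕ} {t : ℝ} (h1 : time1 q (k + 1) ≤ t) (h2 : t < time2 q (k + 1)) :
    haar q (k + 1) t = -2 ^ q := by
  simp [haar, h1, h2, not_lt.2 h1]

theorem haar_of_time2_le {q k : ℕ} {t : ℝ} (h : time2 q (k + 1) ≤ t) :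
    haar q (k + 1) t = 0 := by
  have h1 := time1_lt_time2 q k
  simp [haar, not_lt.2 h, not_lt.2 (h1.le.trans h)]

/-- A dyadic number of level at most `p` does not separate a dyadic cell of level `p`. -/
theorem dyadic_le_or_le {q p : ℕ} (hqp : q ≤ p) (a J : ℕ) :
    (a : ℝ) / 2 ^ q ≤ J / 2 ^ p ∨ ((J : ℝ) + 1) / 2 ^ p ≤ a / 2 ^ q := by
  obtain ⟨r, rfl⟩ := Nat.exists_eq_add_of_le hqp
  have key : (a : ℝ) / 2 ^ q = ((a * 2 ^ r : ℕ) : ℝ) / 2 ^ (q + r) := by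
    rw [pow_add]; push_cast; field_simp
  rw [key]
  rcases Nat.lt_or_ge J (a * 2 ^ r) with h | h
  · right
    gcongr
    exact_mod_cast h
  · left
    gcongr

/-- The position of a dyadic cell of level `p` relative to a Schauder function of level `q < p`. -/
theorem cell_cases {q p : ℕ} (hqp : q < p) (k J : ℕ) :
    ((J : ℝ) + 1) / 2 ^ p ≤ time0 q (k + 1) ∨
    (time0 q (k + 1) ≤ J / 2 ^ p ∧ ((J : ℝ) + 1) / 2 ^ p ≤ time1 q (k + 1)) ∨
    (time1 q (k + 1) ≤ J / 2 ^ p ∧ ((J : ℝ) + 1) / 2 ^ p ≤ time2 q (k + 1)) ∨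
    time2 q (k + 1) ≤ J / 2 ^ p := by
  have h0 := dyadic_le_or_le hqp.le k J
  have h1 := dyadic_le_or_le (Nat.succ_le_of_lt hqp) (2 * k + 1) J
  have h2 := dyadic_le_or_le hqp.le (k + 1) J
  rw [time0_succ, time1_succ, time2_succ]
  push_cast at h0 h1 h2
  tauto

theorem cell_lt (p J : ℕ) : (J : ℝ) / 2 ^ p < ((J : ℝ) + 1) / 2 ^ p := by
  gcongr; linarith

/-- On a dyadic cell of level `p > q`, a Schauder function of level `q` is affine, with slope given
by the Haar function. -/
theorem schauder_affine {q p : ℕ} (hqp : q < p) (n J : ℕ) {t : ℝ} (h0 : (J : ℝ) / 2 ^ p ≤ t)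
    (h1 : t ≤ ((J : ℝ) + 1) / 2 ^ p) :
    schauder q n t = schauder q n (J / 2 ^ p) + haar q n (J / 2 ^ p) * (t - J / 2 ^ p) := by
  have hl := cell_lt p J
  rcases n with _ | k
  · simp only [schauder_zero_right, haar_zero_right]
    split_ifs <;> ring
  · rcases cell_cases hqp k J with h | ⟨h, h'⟩ | ⟨h, h'⟩ | h
    · rw [schauder_of_le_time0 (h1.trans h), schauder_of_le_time0 (hl.le.trans h),
        haar_of_lt_time0 (hl.trans_le h)]
      ring
    · rw [schauder_left (h.trans h0) (h1.trans h'), schauder_left h (hl.le.trans h'),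
        haar_left h (hl.trans_le h')]
      ring
    · rw [schauder_right (h.trans h0) (h1.trans h'), schauder_right h (hl.le.trans h'),
        haar_right h (hl.trans_le h')]
      ring
    · rw [schauder_of_time2_le (h.trans h0), schauder_of_time2_le h, haar_of_time2_le h]
      ring

/-- On a dyadic cell of level `p > q`, a Haar function of level `q` is constant. -/
theorem haar_eq_of_mem_cell {q p : ℕ} (hqp : q < p) (n J : ℕ) {t : ℝ} (h0 : (J : ℝ) / 2 ^ p ≤ t)
    (h1 : t < ((J : ℝ) + 1) / 2 ^ p) :
    haar q n t = haar q n (J / 2 ^ p) := by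
  have hl := cell_lt p J
  rcases n with _ | k
  · simp only [haar_zero_right]
  · rcases cell_cases hqp k J with h | ⟨h, h'⟩ | ⟨h, h'⟩ | h
    · rw [haar_of_lt_time0 (h1.trans_le h), haar_of_lt_time0 (hl.trans_le h)]
    · rw [haar_left (h.trans h0) (h1.trans_le h'), haar_left h (hl.trans_le h')]
    · rw [haar_right (h.trans h0) (h1.trans_le h'), haar_right h (hl.trans_le h')]
    · rw [haar_of_time2_le (h.trans h0), haar_of_time2_le h]

/-- The tent lives on one cell of level p, where the coarser Haar function is constant. Every
integral in a block is thus a multiple of the integral of a single tent. -/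
theorem schauder_mul_haar {q p : ℕ} (hqp : q < p) (n j : ℕ) (s : ℝ) :
    schauder p (j + 1) s * haar q n s = haar q n (j / 2 ^ p) * schauder p (j + 1) s := by
  rcases le_or_gt s (time0 p (j + 1)) with h0 | h0
  · simp [schauder_of_le_time0 h0]
  rcases le_or_gt (time2 p (j + 1)) s with h2 | h2
  · simp [schauder_of_time2_le h2]
  rw [time0_succ] at h0
  rw [time2_succ] at h2
  rw [haar_eq_of_mem_cell hqp n j h0.le h2, mul_comm]

theorem schauder_grid (p n k : ℕ) : schauder p (n + 1) ((k : ℝ) / 2 ^ p) = 0 := by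
  rcases le_or_gt k n with h | h
  · apply schauder_of_le_time0
    rw [time0_succ]
    gcongr
  · apply schauder_of_time2_le
    rw [time2_succ]
    gcongr
    exact_mod_cast h

theorem schauder_mid (p n j : ℕ) :
    schauder p (n + 1) ((2 * (j : ℝ) + 1) / 2 ^ (p + 1)) = if n = j then 1 / 2 else 0 := by
  have hmid (a : ℝ) : a / 2 ^ p = 2 * a / 2 ^ (p + 1) := by rw [pow_succ]; field_simp
  rcases lt_trichotomy j n with h | h | h
  · have h' : (j : ℝ) + 1 ≤ n := by exact_mod_cast h
    rw [if_neg (by omega)]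
    apply schauder_of_le_time0
    rw [time0_succ, hmid]
    gcongr
    linarith
  · subst h
    rw [if_pos rfl, ← time1_succ, schauder_left (time0_lt_time1 p j).le le_rfl, time0_succ,
      time1_succ, pow_succ]
    field_simp
    ring
  · have h' : (n : ℝ) + 1 ≤ j := by exact_mod_cast h
    rw [if_neg (by omega)]
    apply schauder_of_time2_le
    rw [time2_succ, hmid]
    gcongr
    linarith

/-! ### Partial sums of the Schauder expansion as dyadic interpolation -/

section Expansion

variable {E : Type*} [NormedAddCommGroup E]

theorem coeff_succ (f : ℝ → E) (p j : ℕ) :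
    coeff f p (j + 1) = (f ((2 * j + 1) / 2 ^ (p + 1)) - f (j / 2 ^ p)) -
      (f ((j + 1) / 2 ^ p) - f ((2 * j + 1) / 2 ^ (p + 1))) := by
  rw [coeff, if_neg (Nat.succ_ne_zero j), time0_succ, time1_succ, time2_succ]

theorem coeff_zero_of_pos (f : ℝ → E) {p : ℕ} (hp : 0 < p) : coeff f p 0 = 0 := by
  simp [coeff, hp.ne']

variable [NormedSpace ℝ E]

/-- The partial sum of order `N` is affine on the dyadic cells of level `N`, hence on all cells of
levels `≥ N`. -/
theorem partialSum_affine {N p : ℕ} (hNp : N ≤ p) (f : ℝ → E) (J : ℕ) :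
    ∃ c : E, ∀ t, (J : ℝ) / 2 ^ p ≤ t → t ≤ ((J : ℝ) + 1) / 2 ^ p →
      partialSum N f t = partialSum N f (J / 2 ^ p) + (t - J / 2 ^ p) • c := by
  refine ⟨∑ p' ∈ Finset.range N, ∑ m ∈ Finset.range (2 ^ p' + 1),
    haar p' m (J / 2 ^ p) • coeff f p' m, fun t h0 h1 => ?_⟩
  simp only [partialSum, Finset.smul_sum, add_assoc, ← Finset.sum_add_distrib]
  congr 1
  refine Finset.sum_congr rfl fun q hq => Finset.sum_congr rfl fun m _ => ?_
  rw [schauder_affine ((Finset.mem_range.1 hq).trans_le hNp) m J h0 h1, add_smul, smul_smul,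
    mul_comm (t - _)]

theorem partialSum_succ (N : ℕ) (f : ℝ → E) (t : ℝ) :
    partialSum (N + 1) f t = partialSum N f t +
      ∑ m ∈ Finset.range (2 ^ N + 1), schauder N m t • coeff f N m := by
  simp only [partialSum, Finset.sum_range_succ _ N, add_assoc]

theorem partialSum_succ_of_pos {N : ℕ} (hN : 0 < N) (f : ℝ → E) (t : ℝ) :
    partialSum (N + 1) f t = partialSum N f t +
      ∑ n ∈ Finset.range (2 ^ N), schauder N (n + 1) t • coeff f N (n + 1) := by
  rw [partialSum_succ, Finset.sum_range_succ', coeff_zero_of_pos f hN, smul_zero, add_zero]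

/-- The partial sum of order `N ≥ 1` interpolates `f` at the dyadic numbers of level `N`. -/
theorem partialSum_grid (N : ℕ) (f : ℝ → E) (k : ℕ) (hk : k ≤ 2 ^ (N + 1)) :
    partialSum (N + 1) f (k / 2 ^ (N + 1)) = f (k / 2 ^ (N + 1)) := by
  induction N generalizing k with
  -- Order 0 is the constant `f 0`, so the induction starts at order 1, with grid points 0, 1/2 and
  -- 1.
  | zero =>
    have e0 : schauder 0 1 0 = 0 := by simpa using schauder_grid 0 0 0
    have e1 : schauder 0 1 1 = 0 := by simpa using schauder_grid 0 0 1
    have e2 : schauder 0 1 (1 / 2) = 1 / 2 := by simpa using schauder_mid 0 0 0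
    have ec : coeff f 0 1 = (f (1 / 2) - f 0) - (f 1 - f (1 / 2)) := by
      simpa using coeff_succ f 0 0
    have e (t : ℝ) : partialSum 1 f t
        = f 0 + (t • (f 1 - f 0) + schauder 0 1 t • coeff f 0 1) := by
      simp [partialSum, Finset.sum_range_succ, schauder_zero_right, coeff]
    simp only [zero_add, pow_one] at hk ⊢
    rw [e, ec]
    interval_cases k
    · norm_num [e0]
    · norm_num only [Nat.cast_one]
      rw [e2]
      module
    · norm_num [e1]
  | succ N ih =>
    rw [partialSum_succ_of_pos (Nat.succ_pos N)]
    -- Even points belong to the coarser grid, where the new tents vanish. Odd points are midpoints,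
    -- where the only active tent has height 1/2 and corrects the chord by half the second
    -- difference.
    rcases Nat.even_or_odd' k with ⟨j, rfl | rfl⟩
    · have : ((2 * j : ℕ) : ℝ) / 2 ^ (N + 1 + 1) = j / 2 ^ (N + 1) := by
        rw [pow_succ _ (N + 1)]; push_cast; field_simp
      rw [this, ih j (by rw [pow_succ] at hk; omega)]
      simp [schauder_grid]
    · have hj : j < 2 ^ (N + 1) := by rw [pow_succ _ (N + 1)] at hk; omega
      obtain ⟨c, hc⟩ := partialSum_affine (le_refl (N + 1)) f j
      have h0 := ih j hj.le
      have h1 := ih (j + 1) hj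
      push_cast at h1 ⊢
      have hl := cell_lt (N + 1) j
      have hm : (2 * (j : ℝ) + 1) / 2 ^ (N + 1 + 1)
          = (j / 2 ^ (N + 1) + (j + 1) / 2 ^ (N + 1)) / 2 := by
        rw [pow_succ _ (N + 1)]; field_simp; ring
      have hc1 := hc _ hl.le le_rfl
      have hcm := hc ((2 * (j : ℝ) + 1) / 2 ^ (N + 1 + 1)) (by rw [hm]; linarith)
        (by rw [hm]; linarith)
      rw [h1, h0] at hc1
      rw [hcm, h0, Finset.sum_eq_single j]
      · rw [schauder_mid, if_pos rfl, coeff_succ, hc1, hm]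
        module
      · intro n _ hn
        rw [schauder_mid, if_neg hn, zero_smul]
      · intro h
        exact absurd (Finset.mem_range.2 hj) h

theorem partialSum_grid_of_le {p N : ℕ} (hN : 0 < N) (hp : p ≤ N) (f : ℝ → E) (k : ℕ)
    (hk : k ≤ 2 ^ p) : partialSum N f (k / 2 ^ p) = f (k / 2 ^ p) := by
  obtain ⟨N, rfl⟩ := Nat.exists_eq_succ_of_ne_zero hN.ne'
  obtain ⟨r, hr⟩ := Nat.exists_eq_add_of_le hp
  have key : (k : ℝ) / 2 ^ p = ((k * 2 ^ r : ℕ) : ℝ) / 2 ^ (N + 1) := by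
    rw [← Nat.succ_eq_add_one, hr, pow_add]; push_cast; field_simp
  rw [key]
  apply partialSum_grid
  rw [← Nat.succ_eq_add_one, hr, pow_add]
  exact Nat.mul_le_mul_right _ hk

/-- A coefficient of level p < N reads values at dyadic points of level at most p + 1 ≤ N, where the
partial sum interpolates. -/
theorem coeff_partialSum_of_lt {p N m : ℕ} (hp : p < N) (hm : m ≤ 2 ^ p) (f : ℝ → E) :
    coeff (partialSum N f) p m = coeff f p m := by
  have hN : 0 < N := by omega
  rcases m with _ | j
  · have h0 := partialSum_grid_of_le hN (Nat.zero_le N) f 0 (by simp)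
    have h1 := partialSum_grid_of_le hN (Nat.zero_le N) f 1 (by simp)
    norm_num at h0 h1
    simp [coeff, h0, h1]
  · have h0 := partialSum_grid_of_le hN hp.le f j (by omega)
    have h2 := partialSum_grid_of_le hN hp.le f (j + 1) hm
    have h1 := partialSum_grid_of_le hN (Nat.succ_le_of_lt hp) f (2 * j + 1)
      (by rw [Nat.succ_eq_add_one, pow_succ]; omega)
    push_cast at h0 h1 h2
    rw [coeff_succ, coeff_succ, h0, h1, h2]

/-- The coefficient is a second difference over a cell on which the partial sum is affine. -/
theorem coeff_partialSum_of_le {p N m : ℕ} (hp : N ≤ p) (f : ℝ → E) :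
    coeff (partialSum N f) p m = 0 := by
  rcases m with _ | j
  · rcases p with _ | p
    · obtain rfl : N = 0 := by omega
      simp [coeff, partialSum]
    · exact coeff_zero_of_pos _ (Nat.succ_pos p)
  · obtain ⟨c, hc⟩ := partialSum_affine hp f j
    have hl := cell_lt p j
    have hm : (2 * (j : ℝ) + 1) / 2 ^ (p + 1) = (j / 2 ^ p + (j + 1) / 2 ^ p) / 2 := by
      rw [pow_succ _ p]; field_simp; ring
    rw [coeff_succ, hc _ hl.le le_rfl,
      hc ((2 * (j : ℝ) + 1) / 2 ^ (p + 1)) (by rw [hm]; linarith) (by rw [hm]; linarith), hm]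
    module

end Expansion

/-- The Haar series of a function, up to level `p`, is the difference quotient over cells. -/
theorem sum_coeff_mul_haar {p : ℕ} (hp : 0 < p) (w : ℝ → ℝ) {j : ℕ} (hj : j < 2 ^ p) :
    ∑ q ∈ Finset.range p, ∑ n ∈ Finset.range (2 ^ q + 1), coeff w q n * haar q n (j / 2 ^ p) =
      2 ^ p * (w ((j + 1) / 2 ^ p) - w (j / 2 ^ p)) := by
  have h0 := partialSum_grid_of_le hp le_rfl w j hj.le
  have h1 := partialSum_grid_of_le hp le_rfl w (j + 1) hj
  push_cast at h1
  -- Only the values of `w` at the ends of the cell matter, so it may be replaced by its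
  -- interpolation, whose terms are affine there.
  rw [← h0, ← h1]
  simp only [partialSum, add_sub_add_left_eq_sub, ← Finset.sum_sub_distrib, Finset.mul_sum]
  refine Finset.sum_congr rfl fun q hq => Finset.sum_congr rfl fun m _ => ?_
  rw [schauder_affine (Finset.mem_range.1 hq) m j (cell_lt p j).le le_rfl]
  simp only [smul_eq_mul]
  field_simp
  ring

/-! ### The blocks of the Lévy area -/

/-- The increment of `v` over the dyadic cell `i` of level `p`. -/
def inc (v : ℝ → ℝ) (p i : ℕ) : ℝ := v ((i + 1) / 2 ^ p) - v (i / 2 ^ p)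

/-- Twice the area spanned by the increments of `(v, w)` over the two halves of a dyadic cell. -/
def cellArea (v w : ℝ → ℝ) (p j : ℕ) : ℝ :=
  inc v (p + 1) (2 * j) * inc w (p + 1) (2 * j + 1) -
    inc v (p + 1) (2 * j + 1) * inc w (p + 1) (2 * j)

theorem coeff_eq_inc (v : ℝ → ℝ) (p j : ℕ) :
    coeff v p (j + 1) = inc v (p + 1) (2 * j) - inc v (p + 1) (2 * j + 1) := by
  have h0 : (2 * (j : ℝ)) / 2 ^ (p + 1) = j / 2 ^ p := by rw [pow_succ]; field_simp
  have h2 : (2 * (j : ℝ) + 1 + 1) / 2 ^ (p + 1) = (j + 1) / 2 ^ p := by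
    rw [pow_succ]; field_simp; ring
  rw [coeff_succ, inc, inc]
  push_cast
  rw [h0, h2]

theorem inc_eq_add (v : ℝ → ℝ) (p j : ℕ) :
    v ((j + 1) / 2 ^ p) - v (j / 2 ^ p) = inc v (p + 1) (2 * j) + inc v (p + 1) (2 * j + 1) := by
  have h0 : (2 * (j : ℝ)) / 2 ^ (p + 1) = j / 2 ^ p := by rw [pow_succ]; field_simp
  have h2 : (2 * (j : ℝ) + 1 + 1) / 2 ^ (p + 1) = (j + 1) / 2 ^ p := by
    rw [pow_succ]; field_simp; ring
  rw [inc, inc]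
  push_cast
  rw [h0, h2]
  ring

/-- The primitive of `2 ^ (p + 1) φ_{p, j + 1}`. -/
def bump (p j : ℕ) (t : ℝ) : ℝ := 2 ^ (p + 1) * ∫ s in (0 : ℝ)..t, schauder p (j + 1) s

/-- Summing over q first turns the coarse factor into 2^p times the full increment over the cell.
With half increments a, b of `v` and c, e of `w`, (a - b)(c + e) - (a + b)(c - e) = 2(ae - bc),
which leaves only the area of the two halves; the factor 2^(p+1) goes into `bump`. -/
theorem levyBlock_eq {p : ℕ} (hp : 0 < p) (v w : ℝ → ℝ) (t : ℝ) :
    levyBlock v w p t = ∑ j ∈ Finset.range (2 ^ p), cellArea v w p j * bump p j t := by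
  rw [levyBlock]
  have h1 : ∀ q ∈ Finset.range p,
      (∑ m ∈ Finset.range (2 ^ p + 1), ∑ n ∈ Finset.range (2 ^ q + 1),
        (coeff v p m * coeff w q n - coeff v q n * coeff w p m) *
          ∫ s in (0 : ℝ)..t, schauder p m s * haar q n s) =
      ∑ j ∈ Finset.range (2 ^ p), ∑ n ∈ Finset.range (2 ^ q + 1),
        (coeff v p (j + 1) * (coeff w q n * haar q n (j / 2 ^ p)) -
          (coeff v q n * haar q n (j / 2 ^ p)) * coeff w p (j + 1)) *
          ∫ s in (0 : ℝ)..t, schauder p (j + 1) s := by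
    intro q hq
    rw [Finset.sum_range_succ']
    simp only [coeff_zero_of_pos _ hp, zero_mul, mul_zero, sub_zero, Finset.sum_const_zero,
      add_zero]
    refine Finset.sum_congr rfl fun j _ => Finset.sum_congr rfl fun n _ => ?_
    simp only [schauder_mul_haar (Finset.mem_range.1 hq)]
    rw [intervalIntegral.integral_const_mul]
    ring
  rw [Finset.sum_congr rfl h1, Finset.sum_comm]
  refine Finset.sum_congr rfl fun j hj => ?_
  have hj := Finset.mem_range.1 hj
  simp only [← Finset.sum_mul, ← Finset.mul_sum, Finset.sum_sub_distrib]
  rw [sum_coeff_mul_haar hp v hj, sum_coeff_mul_haar hp w hj, coeff_eq_inc, coeff_eq_inc,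
    inc_eq_add, inc_eq_add, cellArea, bump, pow_succ]
  ring

theorem levyBlock_zero (v w : ℝ → ℝ) (t : ℝ) : levyBlock v w 0 t = 0 := by simp [levyBlock]

theorem levyBlock_self (v : ℝ → ℝ) (p : ℕ) (t : ℝ) : levyBlock v v p t = 0 := by
  rw [levyBlock]
  refine Finset.sum_eq_zero fun q _ => Finset.sum_eq_zero fun m _ => Finset.sum_eq_zero fun n _ => ?_
  ring

theorem levyBlock_time_zero (v w : ℝ → ℝ) (p : ℕ) : levyBlock v w p 0 = 0 := by
  simp [levyBlock]

/-- Truncation keeps all coefficients below level N and kills the others, so the series is finite.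
-/
theorem levyArea_partialSum (v w : ℝ → ℝ) (N : ℕ) (t : ℝ) :
    levyArea (partialSum N v) (partialSum N w) t = ∑ p ∈ Finset.range N, levyBlock v w p t := by
  rw [levyArea, tsum_eq_sum (s := Finset.range N)]
  · refine Finset.sum_congr rfl fun p hp => ?_
    have hp := Finset.mem_range.1 hp
    refine Finset.sum_congr rfl fun q hq => Finset.sum_congr rfl fun m hm =>
      Finset.sum_congr rfl fun n hn => ?_
    simp only [Finset.mem_range, Nat.lt_succ_iff] at hq hm hn
    rw [coeff_partialSum_of_lt hp hm, coeff_partialSum_of_lt hp hm,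
      coeff_partialSum_of_lt (hq.trans hp) hn, coeff_partialSum_of_lt (hq.trans hp) hn]
  · intro p hp
    have hp : N ≤ p := by simpa using hp
    simp [levyBlock, coeff_partialSum_of_le hp]

/-! ### Hölder bounds for the blocks -/

/-- A formula without case distinctions, from which continuity and the bound 1/2 follow. -/
theorem schauder_eq_max (p j : ℕ) (t : ℝ) : schauder p (j + 1) t =
    max 0 (min (2 ^ p * (t - time0 p (j + 1))) (2 ^ p * (time2 p (j + 1) - t))) := by
  have h01 := time0_lt_time1 p j
  have h12 := time1_lt_time2 p j
  have hp : (0 : ℝ) < 2 ^ p := by positivity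
  have hmid : time1 p (j + 1) - time0 p (j + 1) = time2 p (j + 1) - time1 p (j + 1) := by
    rw [time0_succ, time1_succ, time2_succ, pow_succ]
    field_simp
    ring
  rcases le_or_gt t (time0 p (j + 1)) with h0 | h0
  · rw [schauder_of_le_time0 h0, max_eq_left]
    exact min_le_of_left_le (mul_nonpos_of_nonneg_of_nonpos hp.le (by linarith))
  rcases le_or_gt t (time1 p (j + 1)) with h1 | h1
  · rw [schauder_left h0.le h1, min_eq_left (by gcongr 2 ^ p * ?_; linarith), max_eq_right]
    exact mul_nonneg hp.le (by linarith)
  rcases le_or_gt t (time2 p (j + 1)) with h2 | h2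
  · rw [schauder_right h1.le h2, min_eq_right (by gcongr 2 ^ p * ?_; linarith), max_eq_right]
    exact mul_nonneg hp.le (by linarith)
  · rw [schauder_of_time2_le h2.le, max_eq_left]
    exact min_le_of_right_le (mul_nonpos_of_nonneg_of_nonpos hp.le (by linarith))

theorem continuous_schauder (p j : ℕ) : Continuous (schauder p (j + 1)) := by
  simp only [funext (schauder_eq_max p j)]
  fun_prop

theorem abs_schauder_le (p j : ℕ) (t : ℝ) : |schauder p (j + 1) t| ≤ 1 / 2 := by
  have hw : (2 : ℝ) ^ p * (time2 p (j + 1) - time0 p (j + 1)) = 1 := by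
    rw [time0_succ, time2_succ]
    field_simp
    ring
  rw [schauder_eq_max, abs_of_nonneg (le_max_left _ _)]
  refine max_le (by norm_num) ?_
  have h1 := min_le_left (2 ^ p * (t - time0 p (j + 1))) (2 ^ p * (time2 p (j + 1) - t))
  have h2 := min_le_right (2 ^ p * (t - time0 p (j + 1))) (2 ^ p * (time2 p (j + 1) - t))
  linarith

theorem intervalIntegrable_schauder (p j : ℕ) (a b : ℝ) :
    IntervalIntegrable (schauder p (j + 1)) volume a b :=
  (continuous_schauder p j).intervalIntegrable a b

theorem abs_bump_sub_le (p j : ℕ) (s t : ℝ) :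
    |bump p j t - bump p j s| ≤ 2 ^ p * |t - s| := by
  have h := intervalIntegral.norm_integral_le_of_norm_le_const (a := s) (b := t)
    (f := schauder p (j + 1)) (fun x _ => abs_schauder_le p j x)
  rw [bump, bump, ← mul_sub, intervalIntegral.integral_interval_sub_left
    (intervalIntegrable_schauder ..) (intervalIntegrable_schauder ..), abs_mul,
    abs_of_pos (by positivity), pow_succ]
  rw [Real.norm_eq_abs] at h
  have hp : (0 : ℝ) < 2 ^ p := by positivity
  nlinarith

theorem bump_eq_zero {p j : ℕ} {t : ℝ} (h0 : 0 ≤ t) (h : t ≤ (j : ℝ) / 2 ^ p) :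
    bump p j t = 0 := by
  rw [bump, intervalIntegral.integral_congr (g := fun _ => 0)]
  · simp
  · intro s hs
    rw [Set.uIcc_of_le h0] at hs
    apply schauder_of_le_time0
    rw [time0_succ]
    exact hs.2.trans h

theorem integral_schauder (p j : ℕ) :
    ∫ s in (j : ℝ) / 2 ^ p..(j + 1) / 2 ^ p, schauder p (j + 1) s = 1 / 2 ^ (p + 2) := by
  have h01 := (time0_lt_time1 p j).le
  have h12 := (time1_lt_time2 p j).le
  rw [← time0_succ, ← time2_succ, ← intervalIntegral.integral_add_adjacent_intervals
    (b := time1 p (j + 1)) (intervalIntegrable_schauder ..) (intervalIntegrable_schauder ..),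
    intervalIntegral.integral_congr (g := fun s => 2 ^ p * (s - time0 p (j + 1))),
    intervalIntegral.integral_congr (b := time2 p (j + 1))
      (g := fun s => 2 ^ p * (time2 p (j + 1) - s))]
  · rw [intervalIntegral.integral_const_mul, intervalIntegral.integral_const_mul,
      intervalIntegral.integral_comp_sub_right (fun x => x),
      intervalIntegral.integral_comp_sub_left (fun x => x), integral_id, integral_id,
      time0_succ, time1_succ, time2_succ, pow_add]
    field_simp
    ring
  · intro s hs
    rw [Set.uIcc_of_le h12] at hs
    exact schauder_right hs.1 hs.2
  · intro s hs
    rw [Set.uIcc_of_le h01] at hs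
    exact schauder_left hs.1 hs.2

/-- A triangle of base 2^(-p) and height 1/2 has area 2^(-p-2), and `bump` rescales it by 2^(p+1).
-/
theorem bump_eq_half {p j : ℕ} {t : ℝ} (h : ((j : ℝ) + 1) / 2 ^ p ≤ t) :
    bump p j t = 1 / 2 := by
  have h0 : bump p j ((j : ℝ) / 2 ^ p) = 0 := bump_eq_zero (by positivity) le_rfl
  have h1 : ∫ s in ((j : ℝ) + 1) / 2 ^ p..t, schauder p (j + 1) s = 0 := by
    rw [intervalIntegral.integral_congr (g := fun _ => 0)]
    · simp
    · intro s hs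
      rw [Set.uIcc_of_le h] at hs
      apply schauder_of_time2_le
      rw [time2_succ]
      exact hs.1
  have hp : (2 : ℝ) ^ (p + 1) ≠ 0 := by positivity
  rw [bump, mul_eq_zero_iff_left hp] at h0
  rw [bump, ← intervalIntegral.integral_add_adjacent_intervals (b := ((j : ℝ) + 1) / 2 ^ p)
    (intervalIntegrable_schauder ..) (intervalIntegrable_schauder ..), h1,
    ← intervalIntegral.integral_add_adjacent_intervals (b := (j : ℝ) / 2 ^ p)
    (intervalIntegrable_schauder ..) (intervalIntegrable_schauder ..), h0, integral_schauder,
    pow_succ _ (p + 1)]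
  field_simp
  norm_num

theorem exists_mem_cell (p : ℕ) {t : ℝ} (ht : t ∈ Set.Icc (0 : ℝ) 1) :
    ∃ J : ℕ, J < 2 ^ p ∧ (J : ℝ) / 2 ^ p ≤ t ∧ t ≤ ((J : ℝ) + 1) / 2 ^ p := by
  have hp : (0 : ℝ) < 2 ^ p := by positivity
  rcases ht.2.lt_or_eq with h1 | h1
  · refine ⟨⌊t * 2 ^ p⌋₊, ?_, ?_, ?_⟩
    · rw [Nat.floor_lt (mul_nonneg ht.1 hp.le)]
      push_cast
      nlinarith
    · rw [div_le_iff₀ hp]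
      exact Nat.floor_le (mul_nonneg ht.1 hp.le)
    · rw [le_div_iff₀ hp]
      exact (Nat.lt_floor_add_one _).le
  · have h : (1 : ℕ) ≤ 2 ^ p := Nat.one_le_two_pow
    refine ⟨2 ^ p - 1, by omega, ?_, ?_⟩ <;> rw [h1]
    · rw [div_le_one hp, Nat.cast_sub h]
      push_cast
      linarith
    · rw [Nat.cast_sub h]
      push_cast
      rw [sub_add_cancel, div_self hp.ne']

/-- Partial sums over cells control the Hölder norm of a sum of bumps. -/
theorem sum_bump_holder {α B : ℝ} (hα0 : 0 < α) (hα1 : α ≤ 1) (hB : 0 ≤ B) (p : ℕ) (y : ℕ → ℝ)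
    (hy : ∀ M N, M ≤ N → N ≤ 2 ^ p →
      |∑ j ∈ Finset.Ico M N, y j| ≤ B * (((N : ℝ) - M) / 2 ^ p) ^ α)
    {s t : ℝ} (hs : s ∈ Set.Icc (0 : ℝ) 1) (ht : t ∈ Set.Icc (0 : ℝ) 1) :
    |∑ j ∈ Finset.range (2 ^ p), y j * bump p j t - ∑ j ∈ Finset.range (2 ^ p), y j * bump p j s|
      ≤ 3 * B * |t - s| ^ α := by
  have hp : (0 : ℝ) < 2 ^ p := by positivity
  set F : ℝ → ℝ := fun t => ∑ j ∈ Finset.range (2 ^ p), y j * bump p j t with hF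
  change |F t - F s| ≤ _
  have hbound {a b a' b' : ℝ} (h : b - a ≤ b' - a') (h0 : 0 ≤ b - a) :
      B * (b - a) ^ α ≤ B * (b' - a') ^ α := by gcongr
  -- Inside one cell only its own bump moves: the earlier ones are complete and the later ones have
  -- not begun.
  have same : ∀ J : ℕ, J < 2 ^ p → ∀ a b, 0 ≤ a → (J : ℝ) / 2 ^ p ≤ a → a ≤ b →
      b ≤ ((J : ℝ) + 1) / 2 ^ p → |F b - F a| ≤ B * (b - a) ^ α := by
    intro J hJ a b ha0 ha hab hb
    have hsum : F b - F a = y J * (bump p J b - bump p J a) := by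
      simp only [hF, ← Finset.sum_sub_distrib, ← mul_sub]
      rw [Finset.sum_eq_single J]
      · intro i _ hi
        rcases lt_or_gt_of_ne hi with h | h
        · have h' : ((i : ℝ) + 1) / 2 ^ p ≤ J / 2 ^ p := by
            gcongr; exact_mod_cast h
          rw [bump_eq_half (h'.trans ha), bump_eq_half (h'.trans (ha.trans hab)), sub_self,
            mul_zero]
        · have h' : ((J : ℝ) + 1) / 2 ^ p ≤ i / 2 ^ p := by
            gcongr; exact_mod_cast h
          rw [bump_eq_zero ha0 (hab.trans (hb.trans h')),
            bump_eq_zero (ha0.trans hab) (hb.trans h'), sub_self, mul_zero]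
      · intro h
        exact absurd (Finset.mem_range.2 hJ) h
    have hyJ := hy J (J + 1) (Nat.le_succ J) hJ
    rw [Nat.Ico_succ_singleton, Finset.sum_singleton] at hyJ
    push_cast at hyJ
    rw [add_sub_cancel_left] at hyJ
    have hx0 : 0 ≤ 2 ^ p * (b - a) := mul_nonneg hp.le (by linarith)
    have hx1 : 2 ^ p * (b - a) ≤ 1 := by
      have h' : (2 : ℝ) ^ p * (((J : ℝ) + 1) / 2 ^ p - J / 2 ^ p) = 1 := by field_simp; ring
      rw [← h']
      gcongr
    have hbump := abs_bump_sub_le p J a b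
    rw [abs_of_nonneg (show 0 ≤ b - a by linarith)] at hbump
    rw [hsum, abs_mul]
    calc |y J| * |bump p J b - bump p J a|
        -- The Lipschitz bound x = 2^p (b - a) is at most 1, so x ≤ x^α; this is where α ≤ 1 enters.
        ≤ (B * (1 / 2 ^ p) ^ α) * (2 ^ p * (b - a)) ^ α := by
          gcongr
          refine hbump.trans ?_
          simpa using Real.rpow_le_rpow_of_exponent_ge' hx0 hx1 hα0.le hα1
      _ = B * (b - a) ^ α := by
          rw [mul_assoc, ← Real.mul_rpow (by positivity) hx0]
          congr 2
          field_simp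
  -- At a grid point exactly the first K bumps are complete, each with value 1/2.
  have grid : ∀ K : ℕ, K ≤ 2 ^ p → F (K / 2 ^ p) = (∑ j ∈ Finset.range K, y j) / 2 := by
    intro K hK
    rw [Finset.sum_div, hF]
    simp only
    rw [← Finset.sum_subset (Finset.range_mono hK)]
    · refine Finset.sum_congr rfl fun i hi => ?_
      have hi := Finset.mem_range.1 hi
      rw [bump_eq_half]
      · ring
      · gcongr; exact_mod_cast hi
    · intro i _ hi
      have hi : K ≤ i := by simpa using hi
      rw [bump_eq_zero (by positivity) (by gcongr), mul_zero]
  -- The path from a to b splits into a piece of a cell, a run of full cells and a last piece of a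
  -- cell; hence the factor 3.
  have main : ∀ a b, 0 ≤ a → a ≤ b → b ≤ 1 → |F b - F a| ≤ 3 * B * (b - a) ^ α := by
    intro a b ha hab hb
    obtain ⟨J, hJ, hJa, haJ⟩ := exists_mem_cell p ⟨ha, hab.trans hb⟩
    obtain ⟨K, hK, hKb, hbK⟩ := exists_mem_cell p ⟨ha.trans hab, hb⟩
    have hnn : 0 ≤ B * (b - a) ^ α := mul_nonneg hB (Real.rpow_nonneg (by linarith) _)
    rcases le_or_gt b (((J : ℝ) + 1) / 2 ^ p) with h | h
    · have := same J hJ a b ha hJa hab h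
      linarith
    · have hJK : J < K := by
        have : (J : ℝ) + 1 < K + 1 := (div_lt_div_iff_of_pos_right hp).1 (h.trans_le hbK)
        exact_mod_cast (by linarith : (J : ℝ) < K)
      have hJK' : ((J : ℝ) + 1) / 2 ^ p ≤ K / 2 ^ p := by gcongr; exact_mod_cast hJK
      have e1 := (same J hJ a _ ha hJa haJ le_rfl).trans
        (hbound (a' := a) (b' := b) (by linarith) (by linarith))
      have e3 := (same K hK _ b (by positivity) le_rfl hKb hbK).trans
        (hbound (a' := a) (b' := b) (by linarith) (by linarith))
      have e2 : |F (K / 2 ^ p) - F (((J : ℝ) + 1) / 2 ^ p)| ≤ B * (b - a) ^ α := by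
        have g := grid (J + 1) (by omega)
        push_cast at g
        rw [grid K hK.le, g, ← sub_div, ← Finset.sum_Ico_eq_sub _ (Nat.succ_le_of_lt hJK), abs_div,
          abs_two]
        have := hy (J + 1) K hJK hK.le
        have h2 : (((K : ℝ) - (J + 1 : ℕ)) / 2 ^ p) ^ α ≤ (b - a) ^ α := by
          push_cast
          rw [sub_div]
          exact Real.rpow_le_rpow (by linarith) (by linarith) hα0.le
        have h3 : |∑ j ∈ Finset.Ico (J + 1) K, y j| ≤ B * (b - a) ^ α :=
          this.trans (by gcongr)
        linarith [abs_nonneg (∑ j ∈ Finset.Ico (J + 1) K, y j)]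
      have tri : F b - F a = (F b - F (K / 2 ^ p)) +
          (F (K / 2 ^ p) - F (((J : ℝ) + 1) / 2 ^ p)) + (F (((J : ℝ) + 1) / 2 ^ p) - F a) := by ring
      rw [tri]
      have := abs_add_three (F b - F (K / 2 ^ p)) (F (K / 2 ^ p) - F (((J : ℝ) + 1) / 2 ^ p))
        (F (((J : ℝ) + 1) / 2 ^ p) - F a)
      linarith
  rcases le_total s t with h | h
  · rw [abs_of_nonneg (sub_nonneg.2 h)]
    exact main s t hs.1 h ht.2
  · rw [abs_sub_comm, abs_sub_comm t, abs_of_nonneg (sub_nonneg.2 h)]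
    exact main t s ht.1 h hs.2

theorem levyBlock_holder {α B : ℝ} (hα0 : 0 < α) (hα1 : α ≤ 1) (hB : 0 ≤ B) (v w : ℝ → ℝ) (p : ℕ)
    (hy : ∀ M N, M ≤ N → N ≤ 2 ^ p →
      |∑ j ∈ Finset.Ico M N, cellArea v w p j| ≤ B * (((N : ℝ) - M) / 2 ^ p) ^ α)
    {s t : ℝ} (hs : s ∈ Set.Icc (0 : ℝ) 1) (ht : t ∈ Set.Icc (0 : ℝ) 1) :
    |levyBlock v w p t - levyBlock v w p s| ≤ 3 * B * |t - s| ^ α := by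
  rcases Nat.eq_zero_or_pos p with rfl | hp
  · rw [levyBlock_zero, levyBlock_zero, sub_self, abs_zero]
    positivity
  · rw [levyBlock_eq hp, levyBlock_eq hp]
    exact sum_bump_holder hα0 hα1 hB p _ hy hs ht

/-! ### Hölder functions and the Schauder norm -/

theorem time_mem_Icc {a b : ℕ} (h : a ≤ 2 ^ b) : (a : ℝ) / 2 ^ b ∈ Set.Icc (0 : ℝ) 1 :=
  ⟨by positivity, div_le_one_of_le₀ (by exact_mod_cast h) (by positivity)⟩

/-- A Hölder continuous function that starts in `0` has a finite Schauder norm. -/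
theorem schauderNorm_le {E : Type*} [NormedAddCommGroup E] {α H : ℝ}
    (hα : 0 < α) (hH : 0 ≤ H) {f : ℝ → E} (hf0 : f 0 = 0)
    (hf : ∀ s ∈ Set.Icc (0 : ℝ) 1, ∀ t ∈ Set.Icc (0 : ℝ) 1, ‖f t - f s‖ ≤ H * |t - s| ^ α) :
    schauderNorm α f ≤ ENNReal.ofReal (2 * H) := by
  refine max_le (by simp [hf0]) (iSup_le fun p => iSup₂_le fun m hm => ?_)
  have hm : m ≤ 2 ^ p := Nat.lt_succ_iff.1 (Finset.mem_range.1 hm)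
  have hp : (0 : ℝ) < 2 ^ p := by positivity
  have key : ‖coeff f p m‖ ≤ 2 * H * (1 / 2 ^ p) ^ α := by
    rcases m with _ | j
    · rcases Nat.eq_zero_or_pos p with rfl | hp
      · have := hf 0 (by simp) 1 (by simp)
        simp [coeff] at this ⊢
        linarith
      · rw [coeff_zero_of_pos f hp, norm_zero]
        positivity
    · have i0 : (j : ℝ) / 2 ^ p ∈ Set.Icc (0 : ℝ) 1 := time_mem_Icc (by omega)
      have i2 := time_mem_Icc hm
      have i1 := time_mem_Icc (a := 2 * j + 1) (b := p + 1) (by rw [pow_succ]; omega)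
      push_cast at i1 i2
      have h1 := hf _ i0 _ i1
      have h2 := hf _ i1 _ i2
      have e1 : |(2 * (j : ℝ) + 1) / 2 ^ (p + 1) - j / 2 ^ p| ≤ 1 / 2 ^ p := by
        have : (2 * (j : ℝ) + 1) / 2 ^ (p + 1) - j / 2 ^ p = (1 / 2) / 2 ^ p := by
          rw [pow_succ]; field_simp; ring
        rw [this, abs_of_pos (by positivity)]
        gcongr
        norm_num
      have e2 : |((j : ℝ) + 1) / 2 ^ p - (2 * (j : ℝ) + 1) / 2 ^ (p + 1)| ≤ 1 / 2 ^ p := by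
        have : ((j : ℝ) + 1) / 2 ^ p - (2 * (j : ℝ) + 1) / 2 ^ (p + 1) = (1 / 2) / 2 ^ p := by
          rw [pow_succ]; field_simp; ring
        rw [this, abs_of_pos (by positivity)]
        gcongr
        norm_num
      rw [coeff_succ]
      refine (norm_sub_le _ _).trans ?_
      have g1 : H * |(2 * (j : ℝ) + 1) / 2 ^ (p + 1) - j / 2 ^ p| ^ α ≤ H * (1 / 2 ^ p) ^ α := by
        gcongr
      have g2 : H * |((j : ℝ) + 1) / 2 ^ p - (2 * (j : ℝ) + 1) / 2 ^ (p + 1)| ^ α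
          ≤ H * (1 / 2 ^ p) ^ α := by
        gcongr
      linarith
  have hpow : (2 : ℝ≥0∞) ^ ((p : ℝ) * α) = ENNReal.ofReal ((2 : ℝ) ^ ((p : ℝ) * α)) := by
    rw [← ENNReal.ofReal_rpow_of_pos two_pos, ENNReal.ofReal_ofNat]
  rw [hpow, ← ofReal_norm, ← ENNReal.ofReal_mul (by positivity)]
  apply ENNReal.ofReal_le_ofReal
  calc (2 : ℝ) ^ ((p : ℝ) * α) * ‖coeff f p m‖
      ≤ (2 : ℝ) ^ ((p : ℝ) * α) * (2 * H * (1 / 2 ^ p) ^ α) := by gcongr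
    _ = 2 * H * (((2 : ℝ) ^ p) ^ α * (1 / 2 ^ p) ^ α) := by
        rw [Real.rpow_mul two_pos.le, Real.rpow_natCast]; ring
    _ = 2 * H := by
        rw [← Real.mul_rpow hp.le (by positivity), mul_one_div_cancel hp.ne', Real.one_rpow,
          mul_one]

/-! ### Frobenius norms and series of Hölder functions -/

theorem frobenius_norm_le {d : ℕ} {A : Matrix (Fin d) (Fin d) ℝ} {c : ℝ} (hc : 0 ≤ c)
    (h : ∀ k l, |A k l| ≤ c) : ‖A‖ ≤ d * c := by
  rw [Matrix.frobenius_norm_def]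
  have : ∑ i, ∑ j, ‖A i j‖ ^ (2 : ℝ) ≤ ((d : ℝ) * c) ^ 2 := by
    calc ∑ i, ∑ j, ‖A i j‖ ^ (2 : ℝ) ≤ ∑ _i : Fin d, ∑ _j : Fin d, c ^ 2 := by
          gcongr with i _ j _
          rw [Real.rpow_two]
          exact pow_le_pow_left₀ (norm_nonneg _) (h i j) 2
      _ = ((d : ℝ) * c) ^ 2 := by simp; ring
  rw [← Real.sqrt_eq_rpow]
  exact Real.sqrt_le_iff.2 ⟨by positivity, this⟩

theorem abs_entry_le_frobenius_norm {d : ℕ} (A : Matrix (Fin d) (Fin d) ℝ) (k l : Fin d) :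
    |A k l| ≤ ‖A‖ := by
  rw [Matrix.frobenius_norm_def, ← Real.sqrt_eq_rpow]
  apply Real.le_sqrt_of_sq_le
  rw [← Real.norm_eq_abs, ← Real.rpow_two]
  calc ‖A k l‖ ^ (2 : ℝ) ≤ ∑ j, ‖A k j‖ ^ (2 : ℝ) :=
        Finset.single_le_sum (f := fun j => ‖A k j‖ ^ (2 : ℝ)) (fun _ _ => by positivity)
          (Finset.mem_univ l)
    _ ≤ _ := Finset.single_le_sum (f := fun i => ∑ j, ‖A i j‖ ^ (2 : ℝ))
          (fun _ _ => by positivity) (Finset.mem_univ k)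

theorem summable_of_holder {α : ℝ} {F : ℕ → ℝ → ℝ} {b : ℕ → ℝ} (hb : Summable b)
    (h0 : ∀ p, F p 0 = 0)
    (hF : ∀ p, ∀ s ∈ Set.Icc (0 : ℝ) 1, ∀ t ∈ Set.Icc (0 : ℝ) 1,
      |F p t - F p s| ≤ b p * |t - s| ^ α) {t : ℝ} (ht : t ∈ Set.Icc (0 : ℝ) 1) :
    Summable (F · t) := by
  refine Summable.of_norm_bounded (hb.mul_right (|t - 0| ^ α)) fun p => ?_
  simpa [h0] using hF p 0 (by simp) t ht

theorem tsum_holder {α : ℝ} {F : ℕ → ℝ → ℝ} {b : ℕ → ℝ} (hb : Summable b)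
    (h0 : ∀ p, F p 0 = 0)
    (hF : ∀ p, ∀ s ∈ Set.Icc (0 : ℝ) 1, ∀ t ∈ Set.Icc (0 : ℝ) 1,
      |F p t - F p s| ≤ b p * |t - s| ^ α)
    {s t : ℝ} (hs : s ∈ Set.Icc (0 : ℝ) 1) (ht : t ∈ Set.Icc (0 : ℝ) 1) :
    |∑' p, F p t - ∑' p, F p s| ≤ (∑' p, b p) * |t - s| ^ α := by
  rw [← (summable_of_holder hb h0 hF ht).tsum_sub (summable_of_holder hb h0 hF hs),
    ← Real.norm_eq_abs]
  exact tsum_of_norm_bounded (hb.hasSum.mul_right _) fun p => hF p s hs t ht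

theorem partialSum_apply {d : ℕ} (f : ℝ → Fin d → ℝ) (N : ℕ) (k : Fin d) :
    (fun s => partialSum N f s k) = partialSum N (fun s => f s k) := by
  funext s
  have hc (p m : ℕ) : coeff f p m k = coeff (fun s => f s k) p m := by
    simp only [coeff]
    split_ifs <;> simp
  simp [partialSum, Finset.sum_apply, hc]

/-- If the blocks have summable Hölder norms, the Lévy areas of the partial sums converge. -/
theorem levyMatrix_convergence {d : ℕ} (f : ℝ → Fin d → ℝ) {α : ℝ} (hα0 : 0 < α) {b : ℕ → ℝ}
    (hb0 : ∀ p, 0 ≤ b p) (hb : Summable b)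
    (hf : ∀ k l p, ∀ s ∈ Set.Icc (0 : ℝ) 1, ∀ t ∈ Set.Icc (0 : ℝ) 1,
      |levyBlock (fun s => f s k) (fun s => f s l) p t -
        levyBlock (fun s => f s k) (fun s => f s l) p s| ≤ b p * |t - s| ^ α) :
    (∑' N : ℕ, schauderNorm α (fun t => levyMatrix (partialSum (N + 1) f) t -
        levyMatrix (partialSum N f) t) < ∞) ∧
      (∀ k l : Fin d, ∀ t ∈ Set.Icc (0 : ℝ) 1,
        Summable (levyBlock (fun s => f s k) (fun s => f s l) · t)) ∧
      Tendsto (fun N : ℕ => schauderNorm α (fun t =>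
          levyMatrix (partialSum (N + 1) f) t - levyMatrix f t)) atTop (𝓝 0) ∧
      TendstoUniformlyOn (fun N : ℕ => levyMatrix (partialSum (N + 1) f)) (levyMatrix f) atTop
        (Set.Icc 0 1) ∧
      ∃ K : ℝ, ∀ s ∈ Set.Icc (0 : ℝ) 1, ∀ t ∈ Set.Icc (0 : ℝ) 1,
        ‖levyMatrix f t - levyMatrix f s‖ ≤ K * |t - s| ^ α := by
  have h0 (k l : Fin d) (p : ℕ) : levyBlock (fun s => f s k) (fun s => f s l) p 0 = 0 :=
    levyBlock_time_zero ..
  have hsummable (k l : Fin d) (t : ℝ) (ht : t ∈ Set.Icc (0 : ℝ) 1) :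
      Summable (levyBlock (fun s => f s k) (fun s => f s l) · t) :=
    summable_of_holder hb (h0 k l) (hf k l) ht
  have hentry (N : ℕ) (k l : Fin d) (t : ℝ) : levyMatrix (partialSum N f) t k l =
      ∑ p ∈ Finset.range N, levyBlock (fun s => f s k) (fun s => f s l) p t := by
    rw [levyMatrix, Matrix.of_apply, partialSum_apply, partialSum_apply, levyArea_partialSum]
  -- The error is minus a tail of the block series, so its Hölder constant is a tail of the summable
  -- sequence `b`. Both modes of convergence follow from this.
  have htail (N : ℕ) (k l : Fin d) (t : ℝ) (ht : t ∈ Set.Icc (0 : ℝ) 1) :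
      (levyMatrix (partialSum N f) t - levyMatrix f t) k l =
      -∑' p, levyBlock (fun s => f s k) (fun s => f s l) (p + N) t := by
    rw [Matrix.sub_apply, hentry, levyMatrix, Matrix.of_apply, levyArea,
      ← (hsummable k l t ht).sum_add_tsum_nat_add N]
    ring
  have hmat {g : ℝ → Matrix (Fin d) (Fin d) ℝ} {c : ℝ} (hc : 0 ≤ c)
      (hg : ∀ k l, ∀ s ∈ Set.Icc (0 : ℝ) 1, ∀ t ∈ Set.Icc (0 : ℝ) 1,
        |g t k l - g s k l| ≤ c * |t - s| ^ α) :
      ∀ s ∈ Set.Icc (0 : ℝ) 1, ∀ t ∈ Set.Icc (0 : ℝ) 1,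
        ‖g t - g s‖ ≤ (d * c) * |t - s| ^ α := by
    intro s hs t ht
    rw [mul_assoc]
    exact frobenius_norm_le (by positivity) fun k l => hg k l s hs t ht
  have hhol : ∀ N, ∀ s ∈ Set.Icc (0 : ℝ) 1, ∀ t ∈ Set.Icc (0 : ℝ) 1,
      ‖(levyMatrix (partialSum N f) t - levyMatrix f t) -
        (levyMatrix (partialSum N f) s - levyMatrix f s)‖
      ≤ (d * ∑' p, b (p + N)) * |t - s| ^ α := by
    intro N
    refine hmat (tsum_nonneg fun p => hb0 _) fun k l s hs t ht => ?_
    rw [htail N k l t ht, htail N k l s hs, neg_sub_neg, abs_sub_comm]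
    exact tsum_holder ((summable_nat_add_iff N).2 hb) (fun p => h0 k l (p + N))
      (fun p => hf k l (p + N)) hs ht
  have hzero (N : ℕ) : levyMatrix (partialSum N f) 0 - levyMatrix f 0 = 0 := by
    ext k l
    rw [htail N k l 0 (by simp)]
    simp [h0]
  have hlim : Tendsto (fun N : ℕ => (d : ℝ) * ∑' p, b (p + (N + 1))) atTop (𝓝 0) := by
    simpa using ((tendsto_sum_nat_add b).comp (tendsto_add_atTop_nat 1)).const_mul (d : ℝ)
  refine ⟨?_, hsummable, ?_, ?_, ?_⟩
  · have hle (N : ℕ) : schauderNorm α (fun t => levyMatrix (partialSum (N + 1) f) t -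
        levyMatrix (partialSum N f) t) ≤ ENNReal.ofReal (2 * (d * b N)) := by
      have hdiff (k l : Fin d) (t : ℝ) : (levyMatrix (partialSum (N + 1) f) t -
          levyMatrix (partialSum N f) t) k l = levyBlock (fun s => f s k) (fun s => f s l) N t := by
        rw [Matrix.sub_apply, hentry, hentry, Finset.sum_range_succ, add_sub_cancel_left]
      have := hb0 N
      refine schauderNorm_le hα0 (by positivity) ?_ (hmat this fun k l s hs t ht => ?_)
      · ext k l
        rw [hdiff, h0, Matrix.zero_apply]
      · rw [hdiff, hdiff]
        exact hf k l N s hs t ht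
    refine (ENNReal.tsum_le_tsum hle).trans_lt ?_
    exact ((hb.mul_left (d : ℝ)).mul_left 2).tsum_ofReal_lt_top
  · have hlim2 : Tendsto (fun N : ℕ => ENNReal.ofReal (2 * ((d : ℝ) * ∑' p, b (p + (N + 1)))))
        atTop (𝓝 0) := by
      simpa using ENNReal.tendsto_ofReal (hlim.const_mul 2)
    refine tendsto_of_tendsto_of_tendsto_of_le_of_le tendsto_const_nhds hlim2
      (fun _ => zero_le) fun N => ?_
    exact schauderNorm_le hα0 (mul_nonneg (Nat.cast_nonneg d) (tsum_nonneg fun p => hb0 _))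
      (hzero (N + 1)) (hhol (N + 1))
  · refine Metric.tendstoUniformlyOn_iff.2 ?_
    intro ε hε
    filter_upwards [hlim.eventually (gt_mem_nhds hε)] with N hN t ht
    rw [dist_comm, dist_eq_norm]
    refine lt_of_le_of_lt ?_ hN
    -- The error vanishes at time 0 and |t|^α ≤ 1, so the Hölder bound is also a uniform bound.
    have h := hhol (N + 1) 0 (by simp) t ht
    rw [hzero (N + 1), sub_zero] at h
    refine h.trans (mul_le_of_le_one_right
      (mul_nonneg (Nat.cast_nonneg d) (tsum_nonneg fun p => hb0 _)) ?_)
    rw [sub_zero, abs_of_nonneg ht.1]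
    exact Real.rpow_le_one ht.1 ht.2 hα0.le
  · refine ⟨_, hmat (c := ∑' p, b p) (tsum_nonneg hb0) fun k l s hs t ht => ?_⟩
    exact tsum_holder hb (h0 k l) (hf k l) hs ht

/-! ### Second moments -/

section Moments

variable {Ω : Type*} [MeasurableSpace Ω] {μ : Measure Ω}

/-- Expanding the square and using independence gives the sum over i, j of E[V_i V_j] E[W_i W_j];
then 2ab ≤ a² + b² separates the two families. -/
theorem integral_sq_sum_mul_le {ι : Type*} (s : Finset ι) (V W : ι → Ω → ℝ)
    (hV : ∀ i ∈ s, MemLp (V i) 2 μ) (hW : ∀ i ∈ s, MemLp (W i) 2 μ)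
    (hind : ∀ i ∈ s, ∀ j ∈ s, IndepFun (fun ω => V i ω * V j ω) (fun ω => W i ω * W j ω) μ) :
    Integrable (fun ω => (∑ i ∈ s, V i ω * W i ω) ^ 2) μ ∧
      ∫ ω, (∑ i ∈ s, V i ω * W i ω) ^ 2 ∂μ ≤
        1 / 2 * (∑ i ∈ s, ∑ j ∈ s, (∫ ω, V i ω * V j ω ∂μ) ^ 2 +
          ∑ i ∈ s, ∑ j ∈ s, (∫ ω, W i ω * W j ω ∂μ) ^ 2) := by
  have hexp : (fun ω => (∑ i ∈ s, V i ω * W i ω) ^ 2) =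
      fun ω => ∑ i ∈ s, ∑ j ∈ s, (V i ω * V j ω) * (W i ω * W j ω) := by
    funext ω
    rw [sq, Finset.sum_mul_sum]
    refine Finset.sum_congr rfl fun i _ => Finset.sum_congr rfl fun j _ => ?_
    ring
  have hVi : ∀ i ∈ s, ∀ j ∈ s, Integrable (fun ω => V i ω * V j ω) μ :=
    fun i hi j hj => (hV i hi).integrable_mul (hV j hj)
  have hWi : ∀ i ∈ s, ∀ j ∈ s, Integrable (fun ω => W i ω * W j ω) μ :=
    fun i hi j hj => (hW i hi).integrable_mul (hW j hj)
  have hint : ∀ i ∈ s, ∀ j ∈ s, Integrable (fun ω => (V i ω * V j ω) * (W i ω * W j ω)) μ :=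
    fun i hi j hj => (hind i hi j hj).integrable_mul (hVi i hi j hj) (hWi i hi j hj)
  rw [hexp]
  refine ⟨integrable_finsetSum _ fun i hi => integrable_finsetSum _ fun j hj => hint i hi j hj, ?_⟩
  rw [integral_finsetSum _ fun i hi => integrable_finsetSum _ fun j hj => hint i hi j hj,
    ← Finset.sum_add_distrib, Finset.mul_sum]
  refine Finset.sum_le_sum fun i hi => ?_
  rw [integral_finsetSum _ fun j hj => hint i hi j hj, ← Finset.sum_add_distrib, Finset.mul_sum]
  refine Finset.sum_le_sum fun j hj => ?_
  have := (hind i hi j hj).integral_fun_mul_eq_mul_integral (hVi i hi j hj).aestronglyMeasurable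
    (hWi i hi j hj).aestronglyMeasurable
  rw [this]
  nlinarith [sq_nonneg ((∫ ω, V i ω * V j ω ∂μ) - ∫ ω, W i ω * W j ω ∂μ)]

variable {d : ℕ} {X : ℝ → Ω → Fin d → ℝ}

/-- The covariance of two dyadic increments of a component of the process. -/
def incCov (μ : Measure Ω) (X : ℝ → Ω → Fin d → ℝ) (k : Fin d) (p i j : ℕ) : ℝ :=
  ∫ ω, inc (fun s => X s ω k) p i * inc (fun s => X s ω k) p j ∂μ

theorem memLp_inc (hL2 : ∀ t ∈ Set.Icc (0 : ℝ) 1, ∀ k, MemLp (fun ω => X t ω k) 2 μ) (k : Fin d)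
    {p i : ℕ} (hi : i < 2 ^ p) : MemLp (fun ω => inc (fun s => X s ω k) p i) 2 μ := by
  have h1 := time_mem_Icc (a := i + 1) hi
  push_cast at h1
  exact (hL2 _ h1 k).sub (hL2 _ (time_mem_Icc hi.le) k)

theorem incCov_eq (hL2 : ∀ t ∈ Set.Icc (0 : ℝ) 1, ∀ k, MemLp (fun ω => X t ω k) 2 μ) (k : Fin d)
    {p i j : ℕ} (hi : i < 2 ^ p) (hj : j < 2 ^ p) :
    incCov μ X k p i j =
      covIncrement μ X (i / 2 ^ p) ((i + 1) / 2 ^ p) (j / 2 ^ p) ((j + 1) / 2 ^ p) k k := by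
  have hi1 := time_mem_Icc (a := i + 1) hi
  have hj1 := time_mem_Icc (a := j + 1) hj
  have hi0 := time_mem_Icc hi.le
  have hj0 := time_mem_Icc hj.le
  push_cast at hi1 hj1
  have I {s t : ℝ} (hs : s ∈ Set.Icc (0 : ℝ) 1) (ht : t ∈ Set.Icc (0 : ℝ) 1) :
      Integrable (fun ω => X s ω k * X t ω k) μ := (hL2 s hs k).integrable_mul (hL2 t ht k)
  simp only [covIncrement, covMatrix, Matrix.sub_apply, Matrix.add_apply, Matrix.of_apply]
  rw [← integral_add (I hi1 hj1) (I hi0 hj0), ← integral_sub _ (I hi0 hj1),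
    ← integral_sub _ (I hi1 hj0)]
  · refine integral_congr_ae (ae_of_all _ fun ω => ?_)
    simp only [inc]
    ring
  · exact ((I hi1 hj1).add (I hi0 hj0)).sub (I hi0 hj1)
  · exact (I hi1 hj1).add (I hi0 hj0)

/-- Integrating |ab| ≤ (a² + b²)/2 reduces a uniform bound on covariances to one on variances. -/
theorem abs_incCov_le (hL2 : ∀ t ∈ Set.Icc (0 : ℝ) 1, ∀ k, MemLp (fun ω => X t ω k) 2 μ)
    (k : Fin d) {p i j : ℕ} (hi : i < 2 ^ p) (hj : j < 2 ^ p) :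
    |incCov μ X k p i j| ≤ (incCov μ X k p i i + incCov μ X k p j j) / 2 := by
  have I {i j : ℕ} (hi : i < 2 ^ p) (hj : j < 2 ^ p) :
      Integrable (fun ω => inc (fun s => X s ω k) p i * inc (fun s => X s ω k) p j) μ :=
    (memLp_inc hL2 k hi).integrable_mul (memLp_inc hL2 k hj)
  rw [incCov, incCov, incCov, ← integral_add (I hi hi) (I hj hj), ← integral_div]
  refine (abs_integral_le_integral_abs).trans (integral_mono (I hi hj).abs
    (((I hi hi).add (I hj hj)).div_const 2) fun ω => ?_)
  rw [abs_le]
  constructor <;>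
  nlinarith [sq_nonneg (inc (fun s => X s ω k) p i - inc (fun s => X s ω k) p j),
    sq_nonneg (inc (fun s => X s ω k) p i + inc (fun s => X s ω k) p j)]

/-- Finite `ρ`-variation of the covariance, `ρ < 2`, bounds the sums of squares of covariances. -/
theorem sum_sq_incCov_le (hL2 : ∀ t ∈ Set.Icc (0 : ℝ) 1, ∀ k, MemLp (fun ω => X t ω k) 2 μ)
    {ρ : ℝ} (hρ1 : 1 ≤ ρ) (hρ2 : ρ < 2) (hvar : RhoVar μ ρ X) :
    ∃ K : ℝ, 0 < K ∧ ∀ (k : Fin d) (p M n : ℕ), M + n ≤ 2 ^ p →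
      ∑ i ∈ Finset.range (2 * n), ∑ j ∈ Finset.range (2 * n),
        incCov μ X k (p + 1) (2 * M + i) (2 * M + j) ^ 2 ≤
        K * ((n : ℝ) / 2 ^ p) * ((2 : ℝ) ^ p) ^ (-(2 / ρ - 1)) := by
  obtain ⟨C, hC, hvar⟩ := hvar
  have hρ0 : 0 < ρ := by linarith
  refine ⟨C ^ (2 / ρ - 1) * C, by positivity, fun k p M n hn => ?_⟩
  have hp : (0 : ℝ) < 2 ^ p := by positivity
  -- The variation condition for the trivial partition of one cell bounds the variance of its
  -- increment.
  have hdiag : ∀ i < 2 ^ (p + 1), |incCov μ X k (p + 1) i i| ≤ (C / 2 ^ p) ^ (1 / ρ) := by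
    intro i hi
    have hi1 := time_mem_Icc (a := i + 1) hi
    have hi0 := time_mem_Icc hi.le
    have := hvar (i / 2 ^ (p + 1)) ((i + 1 : ℕ) / 2 ^ (p + 1)) hi0.1 (by gcongr; omega) hi1.2 1
      (fun a => ((i + a : ℕ) : ℝ) / 2 ^ (p + 1)) (by simp) (by simp)
      (by intro a _; gcongr; omega)
    simp only [Finset.sum_range_one] at this
    push_cast at this
    norm_num only [add_zero, zero_add] at this
    rw [incCov_eq hL2 k hi hi]
    refine (abs_entry_le_frobenius_norm _ k k).trans ?_
    rw [one_div]
    refine (Real.le_rpow_inv_iff_of_pos (norm_nonneg _) (by positivity) hρ0).2 (this.trans ?_)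
    have e : ((i : ℝ) + 1) / 2 ^ (p + 1) - i / 2 ^ (p + 1) = (1 / 2) / 2 ^ p := by
      rw [pow_succ]; field_simp; ring
    rw [e, abs_of_pos (by positivity), ← mul_div_assoc]
    gcongr
    linarith
  have hsup : ∀ i < 2 ^ (p + 1), ∀ j < 2 ^ (p + 1),
      |incCov μ X k (p + 1) i j| ≤ (C / 2 ^ p) ^ (1 / ρ) := by
    intro i hi j hj
    have h1 := (le_abs_self _).trans (hdiag i hi)
    have h2 := (le_abs_self _).trans (hdiag j hj)
    have := abs_incCov_le hL2 k hi hj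
    linarith
  -- The variation condition needs s < t, so the empty range is treated apart.
  rcases Nat.eq_zero_or_pos n with rfl | hn0
  · simp
  have hlt : ∀ i ∈ Finset.range (2 * n), 2 * M + i < 2 ^ (p + 1) := by
    intro i hi
    have := Finset.mem_range.1 hi
    rw [pow_succ]
    omega
  have hterm : ∀ i ∈ Finset.range (2 * n), ∀ j ∈ Finset.range (2 * n),
      incCov μ X k (p + 1) (2 * M + i) (2 * M + j) ^ 2 ≤
      ((C / 2 ^ p) ^ (1 / ρ)) ^ (2 - ρ) *
        ‖covIncrement μ X ((2 * M + i : ℕ) / 2 ^ (p + 1)) ((2 * M + (i + 1) : ℕ) / 2 ^ (p + 1))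
          ((2 * M + j : ℕ) / 2 ^ (p + 1)) ((2 * M + (j + 1) : ℕ) / 2 ^ (p + 1))‖ ^ ρ := by
    intro i hi j hj
    have hs := hsup _ (hlt i hi) _ (hlt j hj)
    have hc := incCov_eq hL2 k (hlt i hi) (hlt j hj)
    have hn := abs_entry_le_frobenius_norm (covIncrement μ X ((2 * M + i : ℕ) / 2 ^ (p + 1))
      (((2 * M + i : ℕ) + 1) / 2 ^ (p + 1)) ((2 * M + j : ℕ) / 2 ^ (p + 1))
      (((2 * M + j : ℕ) + 1) / 2 ^ (p + 1))) k k
    rw [← hc] at hn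
    have e (i : ℕ) : ((2 * M + (i + 1) : ℕ) : ℝ) = (2 * M + i : ℕ) + 1 := by push_cast; ring
    rw [e, e]
    -- The exponent 2 is split as (2 - ρ) + ρ: the first factor takes the uniform bound, the second
    -- is a term of the ρ-variation.
    calc incCov μ X k (p + 1) (2 * M + i) (2 * M + j) ^ 2
        = |incCov μ X k (p + 1) (2 * M + i) (2 * M + j)| ^ (2 - ρ) *
          |incCov μ X k (p + 1) (2 * M + i) (2 * M + j)| ^ ρ := by
          rw [← Real.rpow_add_of_nonneg (abs_nonneg _) (by linarith) hρ0.le, sub_add_cancel,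
            Real.rpow_two, sq_abs]
      _ ≤ _ := by
          gcongr
  have hv := hvar ((2 * M : ℕ) / 2 ^ (p + 1)) ((2 * M + 2 * n : ℕ) / 2 ^ (p + 1)) (by positivity)
    (by gcongr; omega) (time_mem_Icc (by rw [pow_succ]; omega)).2 (2 * n)
    (fun a => ((2 * M + a : ℕ) : ℝ) / 2 ^ (p + 1)) (by simp) (by simp)
    (by intro a _; gcongr; omega)
  have e : ((2 * M + 2 * n : ℕ) : ℝ) / 2 ^ (p + 1) - (2 * M : ℕ) / 2 ^ (p + 1) = n / 2 ^ p := by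
    rw [pow_succ]; push_cast; field_simp; ring
  rw [e, abs_of_nonneg (by positivity)] at hv
  calc ∑ i ∈ Finset.range (2 * n), ∑ j ∈ Finset.range (2 * n),
        incCov μ X k (p + 1) (2 * M + i) (2 * M + j) ^ 2
      ≤ ((C / 2 ^ p) ^ (1 / ρ)) ^ (2 - ρ) * (C * (n / 2 ^ p)) := by
        refine le_trans (Finset.sum_le_sum fun i hi => Finset.sum_le_sum fun j hj =>
          hterm i hi j hj) ?_
        simp only [← Finset.mul_sum]
        gcongr
    _ = C ^ (2 / ρ - 1) * C * ((n : ℝ) / 2 ^ p) * ((2 : ℝ) ^ p) ^ (-(2 / ρ - 1)) := by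
        have e1 : 1 / ρ * (2 - ρ) = 2 / ρ - 1 := by field_simp
        rw [← Real.rpow_mul (by positivity), e1, Real.div_rpow hC.le hp.le, Real.rpow_neg hp.le]
        field_simp

theorem sum_range_two_mul_le {g : ℕ → ℝ} (hg : ∀ i, 0 ≤ g i) {e : ℕ} (he : e ≤ 1) (n : ℕ) :
    ∑ i ∈ Finset.range n, g (2 * i + e) ≤ ∑ a ∈ Finset.range (2 * n), g a := by
  induction n with
  | zero => simp
  | succ n ih =>
    rw [Finset.sum_range_succ, mul_add, mul_one, Finset.sum_range_succ, Finset.sum_range_succ]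
    have h0 := hg (2 * n)
    have h1 := hg (2 * n + 1)
    obtain rfl | rfl := Nat.le_one_iff_eq_zero_or_eq_one.1 he
    · simp only [add_zero] at ih ⊢
      linarith
    · linarith

/-- Increments of different components are independent. -/
theorem indepFun_inc (hindep : iIndepFun
      (fun (k : Fin d) (ω : Ω) (t : Set.Icc (0 : ℝ) 1) => X t ω k) μ)
    {k l : Fin d} (hkl : k ≠ l) {p i j i' j' : ℕ} (hi : i < 2 ^ p) (hj : j < 2 ^ p)
    (hi' : i' < 2 ^ p) (hj' : j' < 2 ^ p) :
    IndepFun (fun ω => inc (fun s => X s ω k) p i * inc (fun s => X s ω k) p j)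
      (fun ω => inc (fun s => X s ω l) p i' * inc (fun s => X s ω l) p j') μ := by
  have h1 {i : ℕ} (hi : i < 2 ^ p) : ((i : ℝ) + 1) / 2 ^ p ∈ Set.Icc (0 : ℝ) 1 := by
    exact_mod_cast time_mem_Icc (a := i + 1) hi
  have hφ {i j : ℕ} (hi : i < 2 ^ p) (hj : j < 2 ^ p) :
      Measurable (fun f : Set.Icc (0 : ℝ) 1 → ℝ =>
        (f ⟨_, h1 hi⟩ - f ⟨_, time_mem_Icc hi.le⟩) *
          (f ⟨_, h1 hj⟩ - f ⟨_, time_mem_Icc hj.le⟩)) := by fun_prop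
  exact (hindep.indepFun hkl).comp (hφ hi hj) (hφ hi' hj')

theorem integral_sq_sum_inc_le
    (hL2 : ∀ t ∈ Set.Icc (0 : ℝ) 1, ∀ k, MemLp (fun ω => X t ω k) 2 μ)
    (hindep : iIndepFun (fun (k : Fin d) (ω : Ω) (t : Set.Icc (0 : ℝ) 1) => X t ω k) μ)
    {k l : Fin d} (hkl : k ≠ l) {p M n : ℕ} (hn : M + n ≤ 2 ^ p) {D : ℝ}
    (hD : ∀ k, ∑ i ∈ Finset.range (2 * n), ∑ j ∈ Finset.range (2 * n),
        incCov μ X k (p + 1) (2 * M + i) (2 * M + j) ^ 2 ≤ D) :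
    Integrable (fun ω => (∑ i ∈ Finset.range n, inc (fun s => X s ω k) (p + 1) (2 * M + 2 * i) *
      inc (fun s => X s ω l) (p + 1) (2 * M + (2 * i + 1))) ^ 2) μ ∧
    ∫ ω, (∑ i ∈ Finset.range n, inc (fun s => X s ω k) (p + 1) (2 * M + 2 * i) *
      inc (fun s => X s ω l) (p + 1) (2 * M + (2 * i + 1))) ^ 2 ∂μ ≤ D := by
  have hlt {e : ℕ} (he : e ≤ 1) : ∀ i ∈ Finset.range n, 2 * M + (2 * i + e) < 2 ^ (p + 1) := by
    intro i hi
    have := Finset.mem_range.1 hi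
    rw [pow_succ]
    omega
  have h0 := hlt (Nat.zero_le 1)
  have h1 := hlt le_rfl
  obtain ⟨hint, hle⟩ := integral_sq_sum_mul_le (μ := μ) (Finset.range n)
    (fun i ω => inc (fun s => X s ω k) (p + 1) (2 * M + 2 * i))
    (fun i ω => inc (fun s => X s ω l) (p + 1) (2 * M + (2 * i + 1)))
    (fun i hi => memLp_inc hL2 k (h0 i hi)) (fun i hi => memLp_inc hL2 l (h1 i hi))
    (fun i hi j hj => indepFun_inc hindep hkl (h0 i hi) (h0 j hj) (h1 i hi) (h1 j hj))
  refine ⟨hint, hle.trans ?_⟩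
  -- First halves of cells have even index and second halves odd index; in either case the sum is
  -- part of the nonnegative sum over all indices.
  have key (k : Fin d) {e : ℕ} (he : e ≤ 1) :
      ∑ i ∈ Finset.range n, ∑ j ∈ Finset.range n,
        incCov μ X k (p + 1) (2 * M + (2 * i + e)) (2 * M + (2 * j + e)) ^ 2 ≤ D := by
    refine le_trans ?_ (hD k)
    refine le_trans (Finset.sum_le_sum fun i _ => sum_range_two_mul_le
      (g := fun a => incCov μ X k (p + 1) (2 * M + (2 * i + e)) (2 * M + a) ^ 2)
      (fun _ => sq_nonneg _) he n) ?_
    exact sum_range_two_mul_le (g := fun b => ∑ a ∈ Finset.range (2 * n),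
      incCov μ X k (p + 1) (2 * M + b) (2 * M + a) ^ 2)
      (fun _ => Finset.sum_nonneg fun _ _ => sq_nonneg _) he n
  have k0 := key k (Nat.zero_le 1)
  have k1 := key l le_rfl
  simp only [incCov, add_zero] at k0 k1
  linarith

/-- The second moments of partial sums of the Lévy area. -/
theorem integral_sq_sum_cellArea_le
    (hL2 : ∀ t ∈ Set.Icc (0 : ℝ) 1, ∀ k, MemLp (fun ω => X t ω k) 2 μ)
    (hindep : iIndepFun (fun (k : Fin d) (ω : Ω) (t : Set.Icc (0 : ℝ) 1) => X t ω k) μ)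
    {ρ : ℝ} (hρ1 : 1 ≤ ρ) (hρ2 : ρ < 2) (hvar : RhoVar μ ρ X) :
    ∃ K : ℝ, 0 < K ∧ ∀ k l : Fin d, k ≠ l → ∀ p M N : ℕ, M ≤ N → N ≤ 2 ^ p →
      Integrable (fun ω =>
        (∑ j ∈ Finset.Ico M N, cellArea (fun s => X s ω k) (fun s => X s ω l) p j) ^ 2) μ ∧
      ∫ ω, (∑ j ∈ Finset.Ico M N, cellArea (fun s => X s ω k) (fun s => X s ω l) p j) ^ 2 ∂μ ≤
        K * (((N : ℝ) - M) / 2 ^ p) * ((2 : ℝ) ^ p) ^ (-(2 / ρ - 1)) := by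
  obtain ⟨K, hK, hle⟩ := sum_sq_incCov_le hL2 hρ1 hρ2 hvar
  refine ⟨4 * K, by positivity, fun k l hkl p M N hMN hN => ?_⟩
  obtain ⟨n, rfl⟩ := Nat.exists_eq_add_of_le hMN
  set D := K * ((n : ℝ) / 2 ^ p) * ((2 : ℝ) ^ p) ^ (-(2 / ρ - 1)) with hD
  -- The two halves of the antisymmetric product differ by exchanging `k` and `l`. Each has second
  -- moment at most `D`, and (a - b)² ≤ 2(a² + b²) gives `4 * D`.
  have hsum (ω : Ω) :
      ∑ j ∈ Finset.Ico M (M + n), cellArea (fun s => X s ω k) (fun s => X s ω l) p j =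
      ∑ i ∈ Finset.range n, inc (fun s => X s ω k) (p + 1) (2 * M + 2 * i) *
        inc (fun s => X s ω l) (p + 1) (2 * M + (2 * i + 1)) -
      ∑ i ∈ Finset.range n, inc (fun s => X s ω l) (p + 1) (2 * M + 2 * i) *
        inc (fun s => X s ω k) (p + 1) (2 * M + (2 * i + 1)) := by
    rw [Finset.sum_Ico_eq_sum_range, add_tsub_cancel_left, ← Finset.sum_sub_distrib]
    refine Finset.sum_congr rfl fun i _ => ?_
    rw [cellArea, mul_add, add_assoc]
    ring
  obtain ⟨I1, h1⟩ := integral_sq_sum_inc_le hL2 hindep hkl hN (fun k => hle k p M n hN)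
  obtain ⟨I2, h2⟩ := integral_sq_sum_inc_le hL2 hindep hkl.symm hN (fun k => hle k p M n hN)
  have I3 := (I1.add I2).const_mul 2
  have hmeas {k l : Fin d} : AEStronglyMeasurable (fun ω =>
      ∑ i ∈ Finset.range n, inc (fun s => X s ω k) (p + 1) (2 * M + 2 * i) *
        inc (fun s => X s ω l) (p + 1) (2 * M + (2 * i + 1))) μ := by
    refine Finset.aestronglyMeasurable_fun_sum _ fun i hi => ?_
    have := Finset.mem_range.1 hi
    exact (memLp_inc hL2 k (by rw [pow_succ]; omega)).aestronglyMeasurable.mul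
      (memLp_inc hL2 l (by rw [pow_succ]; omega)).aestronglyMeasurable
  simp only [hsum]
  have hpt (a b : ℝ) : (a - b) ^ 2 ≤ 2 * (a ^ 2 + b ^ 2) := by nlinarith [sq_nonneg (a + b)]
  have I : Integrable (fun ω => (∑ i ∈ Finset.range n, inc (fun s => X s ω k) (p + 1)
        (2 * M + 2 * i) * inc (fun s => X s ω l) (p + 1) (2 * M + (2 * i + 1)) -
      ∑ i ∈ Finset.range n, inc (fun s => X s ω l) (p + 1) (2 * M + 2 * i) *
        inc (fun s => X s ω k) (p + 1) (2 * M + (2 * i + 1))) ^ 2) μ := by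
    refine I3.mono' ((hmeas.sub hmeas).pow 2) (ae_of_all _ fun ω => ?_)
    rw [Real.norm_eq_abs, abs_of_nonneg (sq_nonneg _)]
    exact hpt _ _
  refine ⟨I, (integral_mono I I3 fun ω => hpt _ _).trans ?_⟩
  have e : 4 * K * (((M + n : ℕ) - M : ℝ) / 2 ^ p) * ((2 : ℝ) ^ p) ^ (-(2 / ρ - 1)) = 4 * D := by
    rw [hD]; push_cast; ring
  rw [e, integral_const_mul, integral_add' I1 I2]
  linarith

end Moments

/-! ### Almost sure bounds -/

section AlmostSure

variable {Ω : Type*} [MeasurableSpace Ω] {μ : Measure Ω} {d : ℕ} {X : ℝ → Ω → Fin d → ℝ}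

/-- Hypercontractivity for polynomials in variables indexed by any finite type. -/
theorem Hypercontractive.fintype (h : Hypercontractive μ X) (m : ℕ) {r : ℝ} (hr : 1 ≤ r) :
    ∃ C : ℝ≥0, 0 < C ∧ ∀ (ι : Type) [Fintype ι] (P : MvPolynomial ι ℝ), P.totalDegree ≤ m →
      ∀ (i : ι → Fin d) (t : ι → ℝ), (∀ k, t k ∈ Set.Icc (0 : ℝ) 1) →
        ∫⁻ ω, ‖MvPolynomial.eval (fun k => X (t k) ω (i k)) P‖ₑ ^ (2 * r) ∂μ ≤
          C * (∫⁻ ω, ‖MvPolynomial.eval (fun k => X (t k) ω (i k)) P‖ₑ ^ (2 : ℝ) ∂μ) ^ r := by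
  obtain ⟨C, hC, hle⟩ := h m r hr
  refine ⟨C, hC, fun ι _ P hP i t ht => ?_⟩
  have e := Fintype.equivFin ι
  have := hle _ (MvPolynomial.rename e P) ((MvPolynomial.totalDegree_rename_le _ _).trans hP)
    (i ∘ e.symm) (t ∘ e.symm) (fun k => ht _)
  simpa [MvPolynomial.eval_rename, Function.comp_def] using this

/-! ### Partial sums of the area as polynomials in grid values -/

/-- The variable for the value of the component `k` at a dyadic time of level `p`. -/
def gridVar (p : ℕ) (k : Fin d) (i : ℕ) : MvPolynomial (Fin (2 ^ p + 1) × Fin d) ℝ :=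
  MvPolynomial.X (Fin.ofNat (2 ^ p + 1) i, k)

/-- The polynomial whose value is an increment over a dyadic cell of level `p`. -/
def gridInc (p : ℕ) (k : Fin d) (i : ℕ) : MvPolynomial (Fin (2 ^ p + 1) × Fin d) ℝ :=
  gridVar p k (i + 1) - gridVar p k i

theorem totalDegree_gridInc (p : ℕ) (k : Fin d) (i : ℕ) : (gridInc p k i).totalDegree ≤ 1 := by
  refine (MvPolynomial.totalDegree_sub _ _).trans (max_le ?_ ?_) <;>
  exact (MvPolynomial.totalDegree_X _).le

theorem eval_gridInc {Ω : Type*} {X : ℝ → Ω → Fin d → ℝ} {p i : ℕ} (hi : i < 2 ^ p) (k : Fin d)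
    (ω : Ω) :
    MvPolynomial.eval (fun a : Fin (2 ^ p + 1) × Fin d => X (((a.1 : ℕ) : ℝ) / 2 ^ p) ω a.2)
      (gridInc p k i) = inc (fun s => X s ω k) p i := by
  simp only [gridInc, gridVar, map_sub, MvPolynomial.eval_X, Fin.val_ofNat, inc]
  -- `Fin.ofNat` reduces modulo 2^p + 1, which changes neither i nor i + 1 when i < 2^p.
  rw [Nat.mod_eq_of_lt (by omega), Nat.mod_eq_of_lt (by omega)]
  push_cast
  rfl

/-- The polynomial whose value is a multiple of a partial sum of the Lévy area. -/
def areaPoly (p M N : ℕ) (k l : Fin d) (c : ℝ) :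
    MvPolynomial (Fin (2 ^ (p + 1) + 1) × Fin d) ℝ :=
  ∑ j ∈ Finset.Ico M N, MvPolynomial.C c *
    (gridInc (p + 1) k (2 * j) * gridInc (p + 1) l (2 * j + 1) -
      gridInc (p + 1) k (2 * j + 1) * gridInc (p + 1) l (2 * j))

theorem totalDegree_areaPoly (p M N : ℕ) (k l : Fin d) (c : ℝ) :
    (areaPoly p M N k l c).totalDegree ≤ 2 := by
  refine MvPolynomial.totalDegree_finsetSum_le fun j _ => ?_
  refine (MvPolynomial.totalDegree_mul _ _).trans ?_
  rw [MvPolynomial.totalDegree_C, zero_add]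
  refine (MvPolynomial.totalDegree_sub _ _).trans (max_le ?_ ?_) <;>
  exact (MvPolynomial.totalDegree_mul _ _).trans
    (add_le_add (totalDegree_gridInc ..) (totalDegree_gridInc ..))

theorem eval_areaPoly {Ω : Type*} {X : ℝ → Ω → Fin d → ℝ} {p M N : ℕ} (hN : N ≤ 2 ^ p) (k l : Fin d) (c : ℝ)
    (ω : Ω) :
    MvPolynomial.eval (fun a : Fin (2 ^ (p + 1) + 1) × Fin d =>
        X (((a.1 : ℕ) : ℝ) / 2 ^ (p + 1)) ω a.2) (areaPoly p M N k l c) =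
      c * ∑ j ∈ Finset.Ico M N, cellArea (fun s => X s ω k) (fun s => X s ω l) p j := by
  rw [areaPoly, map_sum, Finset.mul_sum]
  refine Finset.sum_congr rfl fun j hj => ?_
  have hj := (Finset.mem_Ico.1 hj).2
  have h0 : 2 * j < 2 ^ (p + 1) := by rw [pow_succ]; omega
  have h1 : 2 * j + 1 < 2 ^ (p + 1) := by rw [pow_succ]; omega
  rw [map_mul, map_sub, map_mul, map_mul, MvPolynomial.eval_C, eval_gridInc h0, eval_gridInc h1,
    eval_gridInc h0, eval_gridInc h1, cellArea]

/-- Hypercontractivity turns bounds for second moments of partial sums of the Lévy area into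
bounds for higher moments. -/
theorem lintegral_rpow_cellArea_le (hHC : Hypercontractive μ X) {r : ℝ} (hr : 1 ≤ r) :
    ∃ C : ℝ, 0 < C ∧ ∀ (k l : Fin d) (p M N : ℕ), N ≤ 2 ^ p → ∀ c D : ℝ,
      Integrable (fun ω =>
        (∑ j ∈ Finset.Ico M N, cellArea (fun s => X s ω k) (fun s => X s ω l) p j) ^ 2) μ →
      c ^ 2 * ∫ ω, (∑ j ∈ Finset.Ico M N,
        cellArea (fun s => X s ω k) (fun s => X s ω l) p j) ^ 2 ∂μ ≤ D →
      ∫⁻ ω, ‖c * ∑ j ∈ Finset.Ico M N,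
        cellArea (fun s => X s ω k) (fun s => X s ω l) p j‖ₑ ^ (2 * r) ∂μ ≤
        ENNReal.ofReal (C * D ^ r) := by
  obtain ⟨C, hC, hle⟩ := hHC.fintype 2 hr
  refine ⟨C, hC, fun k l p M N hN c D hint hD => ?_⟩
  have hD0 : 0 ≤ D := le_trans (by positivity) hD
  -- The number of variables grows with p, but the degree stays at most 2, so one constant serves
  -- all levels.
  have key := hle (Fin (2 ^ (p + 1) + 1) × Fin d) (areaPoly p M N k l c)
    (totalDegree_areaPoly ..) (fun a => a.2) (fun a => ((a.1 : ℕ) : ℝ) / 2 ^ (p + 1))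
    (fun a => time_mem_Icc (Nat.lt_succ_iff.1 a.1.2))
  simp only [eval_areaPoly hN] at key
  refine key.trans ?_
  rw [ENNReal.ofReal_mul C.coe_nonneg, ENNReal.ofReal_coe_nnreal,
    ← ENNReal.ofReal_rpow_of_nonneg hD0 (by linarith)]
  gcongr
  have e (x : ℝ) : ‖x‖ₑ ^ (2 : ℝ) = ENNReal.ofReal (x ^ 2) := by
    rw [← ofReal_norm, ENNReal.ofReal_rpow_of_nonneg (norm_nonneg _) two_pos.le,
      Real.rpow_two, Real.norm_eq_abs, sq_abs]
  simp only [e, mul_pow]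
  rw [← ofReal_integral_eq_lintegral_ofReal (hint.const_mul _)
    (ae_of_all _ fun ω => by positivity), integral_const_mul]
  exact ENNReal.ofReal_le_ofReal hD

/-- A family indexed by dyadic intervals whose moments decay fast enough is almost surely
bounded. -/
theorem ae_bounded_of_lintegral_le {Z : ℕ → ℕ → ℕ → Ω → ℝ} {q D : ℝ} (hq : 0 < q) (hD : 0 ≤ D)
    (hZ : ∀ p M N, M < N → N ≤ 2 ^ p → AEMeasurable (Z p M N) μ)
    (hle : ∀ p M N, M < N → N ≤ 2 ^ p →
      ∫⁻ ω, ‖Z p M N ω‖ₑ ^ q ∂μ ≤ ENNReal.ofReal (D / (2 ^ p) ^ 3)) :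
    ∀ᵐ ω ∂μ, ∃ B : ℝ, 0 ≤ B ∧ ∀ p M N, M < N → N ≤ 2 ^ p → |Z p M N ω| ≤ B := by
  set W : ℕ → Ω → ℝ≥0∞ := fun p ω =>
    ∑ N ∈ Finset.range (2 ^ p + 1), ∑ M ∈ Finset.range N, ‖Z p M N ω‖ₑ ^ q with hW
  have hmeas : ∀ p, ∀ N ∈ Finset.range (2 ^ p + 1), ∀ M ∈ Finset.range N,
      AEMeasurable (fun ω => ‖Z p M N ω‖ₑ ^ q) μ := fun p N hN M hM =>
    ((hZ p M N (Finset.mem_range.1 hM)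
      (Nat.lt_succ_iff.1 (Finset.mem_range.1 hN))).enorm).pow_const q
  have hWm (p : ℕ) : AEMeasurable (W p) μ :=
    Finset.aemeasurable_fun_sum _ fun N hN => Finset.aemeasurable_fun_sum _ fun M hM =>
      hmeas p N hN M hM
  have hWle (p : ℕ) : ∫⁻ ω, W p ω ∂μ ≤ ENNReal.ofReal (2 * D * (1 / 2) ^ p) := by
    have hx : (1 : ℝ) ≤ 2 ^ p := one_le_pow₀ one_le_two
    calc ∫⁻ ω, W p ω ∂μ
        = ∑ N ∈ Finset.range (2 ^ p + 1), ∑ M ∈ Finset.range N, ∫⁻ ω, ‖Z p M N ω‖ₑ ^ q ∂μ := by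
          rw [hW, lintegral_finsetSum' _ fun N hN => Finset.aemeasurable_fun_sum _ fun M hM =>
            hmeas p N hN M hM]
          exact Finset.sum_congr rfl fun N hN =>
            lintegral_finsetSum' _ fun M hM => hmeas p N hN M hM
      -- Level p has at most (2^p + 1) 2^p intervals; the cubic decay leaves a geometric series.
      _ ≤ ∑ N ∈ Finset.range (2 ^ p + 1), ∑ _M ∈ Finset.range (2 ^ p),
            ENNReal.ofReal (D / (2 ^ p) ^ 3) := by
          refine Finset.sum_le_sum fun N hN => ?_
          have hN := Nat.lt_succ_iff.1 (Finset.mem_range.1 hN)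
          refine (Finset.sum_le_sum fun M hM => hle p M N (Finset.mem_range.1 hM) hN).trans ?_
          exact Finset.sum_le_sum_of_subset (Finset.range_mono hN)
      _ = ENNReal.ofReal (((2 : ℝ) ^ p + 1) * (2 ^ p * (D / (2 ^ p) ^ 3))) := by
          rw [Finset.sum_const, Finset.sum_const, Finset.card_range, Finset.card_range,
            nsmul_eq_mul, nsmul_eq_mul, ENNReal.ofReal_mul (by positivity),
            ENNReal.ofReal_mul (by positivity), ← ENNReal.ofReal_natCast,
            ← ENNReal.ofReal_natCast]
          push_cast
          rfl
      _ ≤ ENNReal.ofReal (2 * D * (1 / 2) ^ p) := by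
          apply ENNReal.ofReal_le_ofReal
          calc ((2 : ℝ) ^ p + 1) * (2 ^ p * (D / (2 ^ p) ^ 3))
              ≤ (2 ^ p + 2 ^ p) * (2 ^ p * (D / (2 ^ p) ^ 3)) := by gcongr
            _ = 2 * D * (1 / 2) ^ p := by
              rw [div_pow, one_pow]
              field_simp
              ring
  have hfin : ∫⁻ ω, ∑' p, W p ω ∂μ ≠ ∞ := by
    rw [lintegral_tsum hWm]
    refine ((ENNReal.tsum_le_tsum hWle).trans_lt ?_).ne
    exact (summable_geometric_two.mul_left (2 * D)).tsum_ofReal_lt_top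
  filter_upwards [ae_lt_top' (AEMeasurable.tsum hWm) hfin] with ω hω
  -- Each q-th power is one term of the almost surely finite total, so the q-th root of the total
  -- bounds them all.
  refine ⟨((∑' p, W p ω) ^ (1 / q)).toReal, ENNReal.toReal_nonneg, fun p M N hMN hN => ?_⟩
  have h1 : ‖Z p M N ω‖ₑ ^ q ≤ ∑' p, W p ω := by
    refine le_trans ?_ (ENNReal.le_tsum p)
    refine le_trans ?_ (Finset.single_le_sum (f := fun N => ∑ M ∈ Finset.range N,
      ‖Z p M N ω‖ₑ ^ q) (fun _ _ => zero_le) (Finset.mem_range.2 (Nat.lt_succ_iff.2 hN)))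
    exact Finset.single_le_sum (f := fun M => ‖Z p M N ω‖ₑ ^ q) (fun _ _ => zero_le)
      (Finset.mem_range.2 hMN)
  have h2 : ‖Z p M N ω‖ₑ ≤ (∑' p, W p ω) ^ (1 / q) := by
    rw [one_div]
    exact (ENNReal.le_rpow_inv_iff hq).2 h1
  have h3 := ENNReal.toReal_mono (ENNReal.rpow_ne_top_of_nonneg (by positivity) hω.ne) h2
  rwa [toReal_enorm, Real.norm_eq_abs] at h3

/-- Write h = h^(2α) h^(1-2α). The last factor is at most 1 if 2α ≤ 1, and otherwise h ≥ 1/x bounds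
it by x^(2α-1). -/
theorem rpow_le_of_dyadic {α h x : ℝ} (hx : 1 ≤ x) (h0 : 1 / x ≤ h) (h1 : h ≤ 1) :
    h ≤ (h ^ α) ^ 2 * x ^ (max (2 * α - 1) 0) := by
  have hx0 : 0 < x := by linarith
  have hh : 0 < h := lt_of_lt_of_le (by positivity) h0
  have e : h = (h ^ α) ^ 2 * h ^ (1 - 2 * α) := by
    rw [← Real.rpow_two, ← Real.rpow_mul hh.le, ← Real.rpow_add hh]
    ring_nf
    rw [Real.rpow_one]
  nth_rw 1 [e]
  gcongr
  rcases le_total (2 * α - 1) 0 with h2 | h2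
  · rw [max_eq_right h2, Real.rpow_zero]
    exact Real.rpow_le_one hh.le h1 (by linarith)
  · rw [max_eq_left h2, show 1 - 2 * α = -(2 * α - 1) by ring, Real.rpow_neg hh.le,
      ← Real.inv_rpow hh.le]
    gcongr
    rw [inv_le_comm₀ hh hx0, ← one_div]
    exact h0

/-- Each sum is divided by the weight h^α 2^(-pδ/4); high moments of the quotients are then summable
over all dyadic intervals. -/
theorem ae_sum_cellArea_le (hmeas : ∀ t ∈ Set.Icc (0 : ℝ) 1, Measurable (X t))
    (hL2 : ∀ t ∈ Set.Icc (0 : ℝ) 1, ∀ k, MemLp (fun ω => X t ω k) 2 μ)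
    (hindep : iIndepFun (fun (k : Fin d) (ω : Ω) (t : Set.Icc (0 : ℝ) 1) => X t ω k) μ)
    {ρ : ℝ} (hρ1 : 1 ≤ ρ) (hρ2 : ρ < 2) (hHC : Hypercontractive μ X) (hvar : RhoVar μ ρ X)
    {α : ℝ} (hα1 : α < 1 / ρ) :
    ∃ ε : ℝ, 0 < ε ∧ ∀ k l : Fin d, k ≠ l → ∀ᵐ ω ∂μ, ∃ B : ℝ, 0 ≤ B ∧
      ∀ p M N : ℕ, M < N → N ≤ 2 ^ p →
        |∑ j ∈ Finset.Ico M N, cellArea (fun s => X s ω k) (fun s => X s ω l) p j| ≤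
          B * ((2 : ℝ) ^ p) ^ (-ε) * (((N : ℝ) - M) / 2 ^ p) ^ α := by
  have hρ0 : 0 < ρ := by linarith
  have hρ : 0 < 2 / ρ - 1 := by rw [sub_pos, lt_div_iff₀ hρ0]; linarith
  have hρα : 2 * α < 2 / ρ := by
    have : 2 / ρ = 2 * (1 / ρ) := by ring
    linarith
  -- The net gain: the decay exponent 2/ρ - 1 minus the cost of passing from h to h^(2α). It is
  -- positive because α < 1/ρ and ρ < 2.
  obtain ⟨δ, hδ, hδe⟩ : ∃ δ : ℝ, 0 < δ ∧ max (2 * α - 1) 0 - (2 / ρ - 1) = -δ :=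
    ⟨(2 / ρ - 1) - max (2 * α - 1) 0, sub_pos.2 (max_lt (by linarith) hρ), by ring⟩
  obtain ⟨K, hK, hsq⟩ := integral_sq_sum_cellArea_le hL2 hindep hρ1 hρ2 hvar
  -- Chosen so that (2^(-pδ/2))^r ≤ 2^(-3p), the decay needed for the union over intervals;
  -- hypercontractivity requires r ≥ 1.
  set r : ℝ := max 1 (6 / δ) with hr
  have hr1 : 1 ≤ r := le_max_left _ _
  have hrδ : 3 ≤ δ / 2 * r := by
    have : 6 / δ ≤ r := le_max_right _ _
    rw [div_le_iff₀ hδ] at this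
    linarith
  obtain ⟨C, hC, hmom⟩ := lintegral_rpow_cellArea_le hHC hr1
  -- The squared weight uses δ/2 of the gain and the other δ/2 is left for the moments.
  refine ⟨δ / 4, by positivity, fun k l hkl => ?_⟩
  set w : ℕ → ℕ → ℕ → ℝ := fun p M N =>
    (((N : ℝ) - M) / 2 ^ p) ^ α * ((2 : ℝ) ^ p) ^ (-(δ / 4)) with hw
  have hwpos : ∀ p M N, M < N → 0 < w p M N := by
    intro p M N hMN
    have : (0 : ℝ) < (N : ℝ) - M := sub_pos.2 (by exact_mod_cast hMN)
    positivity
  have hae := ae_bounded_of_lintegral_le (μ := μ) (Z := fun p M N ω => (w p M N)⁻¹ *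
      ∑ j ∈ Finset.Ico M N, cellArea (fun s => X s ω k) (fun s => X s ω l) p j)
    (q := 2 * r) (D := C * K ^ r) (by positivity) (by positivity) ?_ ?_
  · filter_upwards [hae] with ω ⟨B, hB, hle⟩
    refine ⟨B, hB, fun p M N hMN hN => ?_⟩
    have h := hle p M N hMN hN
    have hp := hwpos p M N hMN
    rw [abs_mul, abs_of_pos (inv_pos.2 hp), inv_mul_le_iff₀ hp] at h
    refine h.trans (le_of_eq ?_)
    simp only [hw]
    ring
  · intro p M N hMN hN
    refine AEMeasurable.const_mul (Measurable.aemeasurable ?_) _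
    refine Finset.measurable_fun_sum _ fun j hj => ?_
    have hj := (Finset.mem_Ico.1 hj).2
    have hm (k : Fin d) {i : ℕ} (hi : i < 2 ^ (p + 1)) :
        Measurable fun ω => inc (fun s => X s ω k) (p + 1) i := by
      have h1 := time_mem_Icc (a := i + 1) hi
      push_cast at h1
      exact ((measurable_pi_apply k).comp (hmeas _ h1)).sub
        ((measurable_pi_apply k).comp (hmeas _ (time_mem_Icc hi.le)))
    have h0 : 2 * j < 2 ^ (p + 1) := by rw [pow_succ]; omega
    have h1 : 2 * j + 1 < 2 ^ (p + 1) := by rw [pow_succ]; omega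
    exact ((hm k h0).mul (hm l h1)).sub ((hm k h1).mul (hm l h0))
  · intro p M N hMN hN
    obtain ⟨hint, hle⟩ := hsq k l hkl p M N hMN.le hN
    have hx : (1 : ℝ) ≤ 2 ^ p := one_le_pow₀ one_le_two
    have hx0 : (0 : ℝ) < 2 ^ p := by positivity
    have hMN1 : (1 : ℝ) ≤ (N : ℝ) - M := by
      rw [le_sub_iff_add_le]
      exact_mod_cast (by omega : 1 + M ≤ N)
    have hh : 0 < ((N : ℝ) - M) / 2 ^ p := by positivity
    have hdy := rpow_le_of_dyadic (α := α) hx (h := ((N : ℝ) - M) / 2 ^ p) (by gcongr)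
      ((div_le_one hx0).2 (by
        have : (N : ℝ) ≤ 2 ^ p := by exact_mod_cast hN
        have : (0 : ℝ) ≤ M := Nat.cast_nonneg M
        linarith))
    have hp := hwpos p M N hMN
    refine (hmom k l p M N hN (w p M N)⁻¹ (K * ((2 : ℝ) ^ p) ^ (-(δ / 2))) hint ?_).trans ?_
    · rw [inv_pow, inv_mul_le_iff₀ (by positivity)]
      refine hle.trans ?_
      calc K * (((N : ℝ) - M) / 2 ^ p) * ((2 : ℝ) ^ p) ^ (-(2 / ρ - 1))
          ≤ K * (((((N : ℝ) - M) / 2 ^ p) ^ α) ^ 2 * ((2 : ℝ) ^ p) ^ (max (2 * α - 1) 0)) *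
              ((2 : ℝ) ^ p) ^ (-(2 / ρ - 1)) := by gcongr
        _ = K * ((((N : ℝ) - M) / 2 ^ p) ^ α) ^ 2 * ((2 : ℝ) ^ p) ^ (-δ) := by
            rw [← hδe, sub_eq_add_neg (max _ _), Real.rpow_add hx0]
            ring
        _ = w p M N ^ 2 * (K * ((2 : ℝ) ^ p) ^ (-(δ / 2))) := by
            have : ((2 : ℝ) ^ p) ^ (-δ) =
                (((2 : ℝ) ^ p) ^ (-(δ / 4))) ^ 2 * ((2 : ℝ) ^ p) ^ (-(δ / 2)) := by
              rw [← Real.rpow_two, ← Real.rpow_mul hx0.le, ← Real.rpow_add hx0]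
              ring_nf
            rw [this, hw]
            ring
    · apply ENNReal.ofReal_le_ofReal
      rw [Real.mul_rpow hK.le (by positivity), ← Real.rpow_mul hx0.le, ← mul_assoc,
        div_eq_mul_inv]
      refine mul_le_mul_of_nonneg_left ?_ (by positivity)
      have e : (((2 : ℝ) ^ p) ^ 3)⁻¹ = ((2 : ℝ) ^ p) ^ (-(3 : ℝ)) := by
        rw [Real.rpow_neg hx0.le, ← Real.rpow_natCast _ 3, Nat.cast_ofNat]
      rw [e]
      apply Real.rpow_le_rpow_of_exponent_le hx
      linarith

end AlmostSure

end LevyArea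

end

/-! ### From the almost sure bounds to the theorem -/

theorem theorem6p4 {Ω : Type*} [MeasurableSpace Ω] (μ : Measure Ω) [IsProbabilityMeasure μ]
    {d : ℕ} (X : ℝ → Ω → Fin d → ℝ)
    (hmeas : ∀ t ∈ Set.Icc (0 : ℝ) 1, Measurable (X t))
    (hcont : ∀ᵐ ω ∂μ, ContinuousOn (fun t => X t ω) (Set.Icc 0 1))
    (hL2 : ∀ t ∈ Set.Icc (0 : ℝ) 1, ∀ k, MemLp (fun ω => X t ω k) 2 μ)
    (hcentered : ∀ t ∈ Set.Icc (0 : ℝ) 1, ∀ k, ∫ ω, X t ω k ∂μ = 0)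
    (hindep : iIndepFun (fun (k : Fin d) (ω : Ω) (t : Set.Icc (0 : ℝ) 1) => X t ω k) μ)
    (ρ : ℝ) (hρ1 : 1 ≤ ρ) (hρ2 : ρ < 2)
    (hHC : LevyArea.Hypercontractive μ X) (hvar : LevyArea.RhoVar μ ρ X)
    (α : ℝ) (hα0 : 0 < α) (hα1 : α < 1 / ρ) :
    ∀ᵐ ω ∂μ,
      -- with `S_N = partialSum (N + 1)`: the increments are summable in the norm of order `α`
      (∑' N : ℕ, LevyArea.schauderNorm α (fun t =>
          LevyArea.levyMatrix (LevyArea.partialSum (N + 1) (fun s => X s ω)) t -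
            LevyArea.levyMatrix (LevyArea.partialSum N (fun s => X s ω)) t) < ∞) ∧
      -- the series that defines the Lévy area of `X` converges on `[0, 1]`
      (∀ k l : Fin d, ∀ t ∈ Set.Icc (0 : ℝ) 1,
        Summable (LevyArea.levyBlock (fun s => X s ω k) (fun s => X s ω l) · t)) ∧
      -- it is the limit of the Lévy areas of `S_N X`, in the norm of order `α` and uniformly
      Tendsto (fun N : ℕ => LevyArea.schauderNorm α (fun t =>
          LevyArea.levyMatrix (LevyArea.partialSum (N + 1) (fun s => X s ω)) t -
            LevyArea.levyMatrix (fun s => X s ω) t)) atTop (𝓝 0) ∧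
      TendstoUniformlyOn
        (fun N : ℕ => LevyArea.levyMatrix (LevyArea.partialSum (N + 1) (fun s => X s ω)))
        (LevyArea.levyMatrix (fun s => X s ω)) atTop (Set.Icc 0 1) ∧
      -- and it is Hölder continuous of order `α`
      ∃ K : ℝ, ∀ s ∈ Set.Icc (0 : ℝ) 1, ∀ t ∈ Set.Icc (0 : ℝ) 1,
        ‖LevyArea.levyMatrix (fun s => X s ω) t - LevyArea.levyMatrix (fun s => X s ω) s‖ ≤
          K * |t - s| ^ α := by
  have hα1' : α ≤ 1 := hα1.le.trans (div_le_one_of_le₀ hρ1 (by linarith))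
  obtain ⟨ε, hε, hae⟩ :=
    LevyArea.ae_sum_cellArea_le hmeas hL2 hindep hρ1 hρ2 hHC hvar hα1
  have hall : ∀ᵐ ω ∂μ, ∀ k l : Fin d, k ≠ l → ∃ B : ℝ, 0 ≤ B ∧
      ∀ p M N : ℕ, M < N → N ≤ 2 ^ p →
        |∑ j ∈ Finset.Ico M N, LevyArea.cellArea (fun s => X s ω k) (fun s => X s ω l) p j| ≤
          B * ((2 : ℝ) ^ p) ^ (-ε) * (((N : ℝ) - M) / 2 ^ p) ^ α := by
    simp only [ae_all_iff]
    exact hae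
  filter_upwards [hall] with ω hω
  choose! B hB0 hB using hω
  -- One constant for all pairs. The absolute values are needed since `choose!` says nothing about
  -- `B` on the diagonal.
  set S : ℝ := ∑ k, ∑ l, |B k l|
  have hBS (k l : Fin d) : |B k l| ≤ S :=
    (Finset.single_le_sum (f := fun l => |B k l|) (fun _ _ => abs_nonneg _)
      (Finset.mem_univ l)).trans (Finset.single_le_sum (f := fun k => ∑ l, |B k l|)
      (fun _ _ => Finset.sum_nonneg fun _ _ => abs_nonneg _) (Finset.mem_univ k))
  have hS : 0 ≤ S := Finset.sum_nonneg fun _ _ => Finset.sum_nonneg fun _ _ => abs_nonneg _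
  have hgeom : Summable fun p : ℕ => ((2 : ℝ) ^ p) ^ (-ε) := by
    have e (p : ℕ) : ((2 : ℝ) ^ p) ^ (-ε) = ((2 : ℝ) ^ (-ε)) ^ p := by
      rw [← Real.rpow_natCast, ← Real.rpow_natCast, ← Real.rpow_mul two_pos.le,
        ← Real.rpow_mul two_pos.le, mul_comm]
    simp only [e]
    exact summable_geometric_of_lt_one (by positivity)
      (Real.rpow_lt_one_of_one_lt_of_neg one_lt_two (by linarith))
  refine LevyArea.levyMatrix_convergence (fun s => X s ω) hα0
    (b := fun p => 3 * (S * ((2 : ℝ) ^ p) ^ (-ε))) (fun p => by positivity)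
    ((hgeom.mul_left S).mul_left 3) fun k l p s hs t ht => ?_
  rcases eq_or_ne k l with rfl | hkl
  · rw [LevyArea.levyBlock_self, LevyArea.levyBlock_self, sub_self, abs_zero]
    positivity
  · refine LevyArea.levyBlock_holder hα0 hα1' (by positivity) _ _ p (fun M N hMN hN => ?_) hs ht
    -- The almost sure bound covers nonempty ranges only; for an empty one both sides are 0, as 0^α
    -- = 0.
    rcases hMN.eq_or_lt with rfl | hMN
    · simp [hα0.ne']
    · have hd : (0 : ℝ) ≤ (N : ℝ) - M := sub_nonneg.2 (by exact_mod_cast hMN.le)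
      refine (hB k l hkl p M N hMN hN).trans ?_
      gcongr
      exact (le_abs_self _).trans (hBS k l)
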